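/- Let $G$ be a finite group, let $\operatorname{Rep}(G)$ be the symmetric monoidal category of finite-dimensional complex representations of $G$ with its canonical spherical pivotal structure (the one with trivial twist, for which the pivotal dimension is the vector space dimension), and let $\mathcal{Z}=\mathcal{Z}(\operatorname{Rep}(G))$ be its Drinfeld center with the half-braiding as braiding $c$ and with the inherited spherical pivotal structure $j\colon\operatorname{id}\to(-)^{**}$. Let $u\colon\operatorname{id}\to(-)^{**}$ be the Drinfeld isomorphism of $\mathcal{Z}$, i.e. the composite $X\to X\otimes X^*\otimes X^{**}\xrightarrow{c}X^*\otimes X\otimes X^{**}\to X^{**}$, and let $\theta=u^{-1}j$ be the twist; for a simple object $X$ write $\theta_X\in\mathbb{C}$ for the scalar by which it acts on $X$, and $\dim(X)$ for the pivotal dimension. Then $\mathcal{Z}$ has finitely many isomorphism classes of simple objects, and for every $n\in\mathbb{Z}$ the $n$-th Gauss sum $$\tau_n(\mathcal{Z})=\sum_{X}\theta_X^{\,n}\dim(X)^2,$$ where $X$ runs over representatives of the isomorphism classes of simple objects of $\mathcal{Z}$, satisfies $$\tau_n(\mathcal{Z})=\tau_{-n}(\mathcal{Z})=|G|\cdot\#\{x\in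 G : x^n=1\}>0 .$$ -/

import Mathlib

noncomputable section

namespace HigherGauss

open CategoryTheory MonoidalCategory

universe w v u

local postfix:1024 "ᵛ" => HasRightDual.rightDual
local postfix:1024 "ᵗ" => rightAdjointMate


section Mates

variable {C : Type u} [Category.{v} C] [MonoidalCategory C]

/-- If `Y` is dual to `X` (so there are `η : 𝟙 ⟶ X ⊗ Y` and `ε : Y ⊗ X ⟶ 𝟙`), a morphism
`b : U ⊗ X ⟶ X ⊗ U` is turned into `Y ⊗ U ⟶ U ⊗ Y` by bending both `X`-strands. -/
def dualMate {X U : C} (Y : C) [ExactPairing X Y] (b : U ⊗ X ⟶ X ⊗ U) : Y ⊗ U ⟶ U ⊗ Y :=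
  𝟙 _ ⊗≫ (Y ⊗ U) ◁ η_ X Y ⊗≫ Y ◁ b ▷ Y ⊗≫ ε_ X Y ▷ (U ⊗ Y) ⊗≫ 𝟙 _

variable {X Y U : C} [ExactPairing X Y] (b : U ⊗ X ⟶ X ⊗ U)

theorem coevaluation_dualMate :
    η_ X Y ▷ U ⊗≫ X ◁ dualMate Y b = 𝟙 _ ⊗≫ U ◁ η_ X Y ⊗≫ b ▷ Y ⊗≫ 𝟙 _ := by
  calc
    _ = 𝟙 _ ⊗≫ (η_ X Y ▷ (U ⊗ 𝟙_ C) ≫ (X ⊗ Y) ◁ (U ◁ η_ X Y)) ⊗≫ (X ⊗ Y) ◁ b ▷ Y ⊗≫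
        X ◁ (ε_ X Y ▷ (U ⊗ Y)) ⊗≫ 𝟙 _ := by
      dsimp only [dualMate]; monoidal
    _ = 𝟙 _ ⊗≫ U ◁ η_ X Y ⊗≫ (η_ X Y ▷ (U ⊗ X) ≫ (X ⊗ Y) ◁ b) ▷ Y ⊗≫
        X ◁ (ε_ X Y ▷ (U ⊗ Y)) ⊗≫ 𝟙 _ := by
      rw [← whisker_exchange]; monoidal
    _ = 𝟙 _ ⊗≫ U ◁ η_ X Y ⊗≫ b ▷ Y ⊗≫ (η_ X Y ▷ X ⊗≫ X ◁ ε_ X Y) ▷ (U ⊗ Y) ⊗≫ 𝟙 _ := by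
      rw [← whisker_exchange]; monoidal
    _ = _ := by
      rw [ExactPairing.evaluation_coevaluation'']; monoidal

theorem dualMate_evaluation :
    dualMate Y b ▷ X ⊗≫ U ◁ ε_ X Y = 𝟙 _ ⊗≫ Y ◁ b ⊗≫ ε_ X Y ▷ U ⊗≫ 𝟙 _ := by
  calc
    _ = 𝟙 _ ⊗≫ (Y ⊗ U) ◁ (η_ X Y ▷ X) ⊗≫ Y ◁ b ▷ (Y ⊗ X) ⊗≫
        (ε_ X Y ▷ (U ⊗ Y ⊗ X) ≫ 𝟙_ C ◁ (U ◁ ε_ X Y)) ⊗≫ 𝟙 _ := by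
      dsimp only [dualMate]; monoidal
    _ = 𝟙 _ ⊗≫ (Y ⊗ U) ◁ (η_ X Y ▷ X) ⊗≫ Y ◁ (b ▷ (Y ⊗ X) ≫ (X ⊗ U) ◁ ε_ X Y) ⊗≫
        ε_ X Y ▷ U ⊗≫ 𝟙 _ := by
      rw [← whisker_exchange]; monoidal
    _ = 𝟙 _ ⊗≫ (Y ⊗ U) ◁ (η_ X Y ▷ X ⊗≫ X ◁ ε_ X Y) ⊗≫ Y ◁ b ⊗≫ 
        ε_ X Y ▷ U ⊗≫ 𝟙 _ := by
      rw [← whisker_exchange]; monoidal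
    _ = _ := by
      rw [ExactPairing.evaluation_coevaluation'']; monoidal

theorem dualMate_natural {U V : C} (f : U ⟶ V) (b : U ⊗ X ⟶ X ⊗ U) (c : V ⊗ X ⟶ X ⊗ V)
    (h : f ▷ X ≫ c = b ≫ X ◁ f) :
    Y ◁ f ≫ dualMate Y c = dualMate Y b ≫ f ▷ Y := by
  calc
    _ = 𝟙 _ ⊗≫ Y ◁ (f ▷ 𝟙_ C ≫ V ◁ η_ X Y) ⊗≫ Y ◁ c ▷ Y ⊗≫ ε_ X Y ▷ (V ⊗ Y) ⊗≫ 𝟙 _ := by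
      dsimp only [dualMate]; monoidal
    _ = 𝟙 _ ⊗≫ (Y ⊗ U) ◁ η_ X Y ⊗≫ Y ◁ (f ▷ X ≫ c) ▷ Y ⊗≫ ε_ X Y ▷ (V ⊗ Y) ⊗≫ 𝟙 _ := by
      rw [← whisker_exchange]; monoidal
    _ = 𝟙 _ ⊗≫ (Y ⊗ U) ◁ η_ X Y ⊗≫ Y ◁ b ▷ Y ⊗≫
        ((Y ⊗ X) ◁ (f ▷ Y) ≫ ε_ X Y ▷ (V ⊗ Y)) ⊗≫ 𝟙 _ := by
      rw [h]; monoidal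
    _ = _ := by
      rw [whisker_exchange]; dsimp only [dualMate]; monoidal

theorem dualMate_tensor {U V : C} (b : U ⊗ X ⟶ X ⊗ U) (c : V ⊗ X ⟶ X ⊗ V) :
    dualMate Y ((α_ U V X).hom ≫ U ◁ c ≫ (α_ U X V).inv ≫ b ▷ V ≫ (α_ X U V).hom) =
      (α_ Y U V).inv ≫ dualMate Y b ▷ V ≫ (α_ U Y V).hom ≫ U ◁ dualMate Y c ≫
        (α_ U V Y).inv := by
  symm
  calc
    _ = 𝟙 _ ⊗≫ Y ◁ U ◁ η_ X Y ▷ V ⊗≫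
        ((Y ◁ b ⊗≫ ε_ X Y ▷ U) ▷ (Y ⊗ V) ≫ (𝟙_ C ⊗ U) ◁ dualMate Y c) ⊗≫ 𝟙 _ := by
      rw [dualMate.eq_def Y b]; monoidal
    _ = 𝟙 _ ⊗≫ Y ◁ U ◁ (η_ X Y ▷ V ⊗≫ X ◁ dualMate Y c) ⊗≫
        (Y ◁ b ⊗≫ ε_ X Y ▷ U) ▷ (V ⊗ Y) ⊗≫ 𝟙 _ := by
      rw [← whisker_exchange]; monoidal
    _ = _ := by
      rw [coevaluation_dualMate]; dsimp only [dualMate]; monoidal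

theorem dualMate_unit : dualMate Y ((λ_ X).hom ≫ (ρ_ X).inv) = (ρ_ Y).hom ≫ (λ_ Y).inv := by
  calc
    _ = 𝟙 _ ⊗≫ (Y ◁ η_ X Y ⊗≫ ε_ X Y ▷ Y) ⊗≫ 𝟙 _ := by
      dsimp only [dualMate]; monoidal
    _ = _ := by
      rw [ExactPairing.coevaluation_evaluation'']; monoidal

end Mates

section Lax

variable {C : Type u} [Category.{v} C] [MonoidalCategory C] {Y : C}

/-- Bending the strands of `D` in `Y ⊗ D ⟶ D ⊗ Y` gives the inverse at `U` of a natural and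
monoidal family of morphisms `Y ⊗ U ⟶ U ⊗ Y`, see the two theorems below. -/
def crossInv {D U : C} [ExactPairing D U] (s : Y ⊗ D ⟶ D ⊗ Y) : U ⊗ Y ⟶ Y ⊗ U :=
  𝟙 _ ⊗≫ (U ⊗ Y) ◁ η_ D U ⊗≫ U ◁ s ▷ U ⊗≫ ε_ D U ▷ (Y ⊗ U) ⊗≫ 𝟙 _

theorem cross_crossInv {σ : ∀ U : C, Y ⊗ U ⟶ U ⊗ Y}
  (nat : ∀ {U V : C} (f : U ⟶ V), Y ◁ f ≫ σ V = σ U ≫ f ▷ Y)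
  (mon : ∀ U V : C, σ (U ⊗ V) = (α_ Y U V).inv ≫ σ U ▷ V ≫ (α_ U Y V).hom ≫ U ◁ σ V ≫
    (α_ U V Y).inv)
  (unit : σ (𝟙_ C) = (ρ_ Y).hom ≫ (λ_ Y).inv)
  {D U : C} [ExactPairing D U] : σ U ≫ crossInv (σ D) = 𝟙 _ := by
  have key : σ U ▷ D ⊗≫ U ◁ σ D ⊗≫ ε_ D U ▷ Y = 𝟙 _ ⊗≫ Y ◁ ε_ D U ⊗≫ 𝟙 _ := by
    have h1 := nat (ε_ D U)
    rw [mon, unit] at h1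
    calc
      _ = (α_ _ _ _).hom ≫ (((α_ Y U D).inv ≫ σ U ▷ D ≫ (α_ U Y D).hom ≫ U ◁ σ D ≫
        (α_ U D Y).inv) ≫ ε_ D U ▷ Y) := by monoidal
      _ = _ := by rw [← h1]; monoidal
  calc
    _ = 𝟙 _ ⊗≫ (σ U ▷ 𝟙_ C ≫ (U ⊗ Y) ◁ η_ D U) ⊗≫ U ◁ σ D ▷ U ⊗≫ ε_ D U ▷ (Y ⊗ U) ⊗≫ 𝟙 _ := by
      dsimp only [crossInv]; monoidal
    _ = 𝟙 _ ⊗≫ (Y ⊗ U) ◁ η_ D U ⊗≫ (σ U ▷ D ⊗≫ U ◁ σ D ⊗≫ ε_ D U ▷ Y) ▷ U ⊗≫ 𝟙 _ := by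
      rw [← whisker_exchange]; monoidal
    _ = 𝟙 _ ⊗≫ Y ◁ (U ◁ η_ D U ⊗≫ ε_ D U ▷ U) ⊗≫ 𝟙 _ := by
      rw [key]; monoidal
    _ = _ := by
      rw [ExactPairing.coevaluation_evaluation'']; monoidal

theorem crossInv_cross {σ : ∀ U : C, Y ⊗ U ⟶ U ⊗ Y}
  (nat : ∀ {U V : C} (f : U ⟶ V), Y ◁ f ≫ σ V = σ U ≫ f ▷ Y)
  (mon : ∀ U V : C, σ (U ⊗ V) = (α_ Y U V).inv ≫ σ U ▷ V ≫ (α_ U Y V).hom ≫ U ◁ σ V ≫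
    (α_ U V Y).inv)
  (unit : σ (𝟙_ C) = (ρ_ Y).hom ≫ (λ_ Y).inv)
  {D U : C} [ExactPairing D U] : crossInv (σ D) ≫ σ U = 𝟙 _ := by
  have key : Y ◁ η_ D U ⊗≫ σ D ▷ U ⊗≫ D ◁ σ U = 𝟙 _ ⊗≫ η_ D U ▷ Y ⊗≫ 𝟙 _ := by
    have h1 := nat (η_ D U)
    rw [mon, unit] at h1
    calc
      _ = (Y ◁ η_ D U ≫ (α_ Y D U).inv ≫ σ D ▷ U ≫ (α_ D Y U).hom ≫ D ◁ σ U ≫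
        (α_ D U Y).inv) ≫ (α_ _ _ _).hom := by monoidal
      _ = _ := by rw [h1]; monoidal
  calc
    _ = 𝟙 _ ⊗≫ (U ⊗ Y) ◁ η_ D U ⊗≫ U ◁ σ D ▷ U ⊗≫ (ε_ D U ▷ (Y ⊗ U) ≫ 𝟙_ C ◁ σ U) ⊗≫ 𝟙 _ := by
      dsimp only [crossInv]; monoidal
    _ = 𝟙 _ ⊗≫ U ◁ (Y ◁ η_ D U ⊗≫ σ D ▷ U ⊗≫ D ◁ σ U) ⊗≫ ε_ D U ▷ (U ⊗ Y) ⊗≫ 𝟙 _ := by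
      rw [← whisker_exchange]; monoidal
    _ = 𝟙 _ ⊗≫ (U ◁ η_ D U ⊗≫ ε_ D U ▷ U) ▷ Y ⊗≫ 𝟙 _ := by
      rw [key]; monoidal
    _ = _ := by
      rw [ExactPairing.coevaluation_evaluation'']; monoidal

end Lax

section Duals

variable {C : Type u} [Category.{v} C] [MonoidalCategory C]

theorem rightDual_hom_ext {X Y Z : C} [ExactPairing X Y] {f g : Z ⟶ Y}
    (h : f ▷ X ≫ ε_ X Y = g ▷ X ≫ ε_ X Y) : f = g := by
  let _ : HasRightDual X := ⟨Y⟩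
  have key : ∀ k : Z ⟶ Y, tensorRightHomEquiv Z X Y (𝟙_ C) (k ▷ X ≫ ε_ X Y) = k ≫ (λ_ Y).inv :=
    fun k => tensorRightHomEquiv_whiskerRight_comp_evaluation (X := X) k
  have := key f
  rw [h, key g] at this
  exact ((cancel_mono _).1 this).symm

theorem rightDualIso_hom_evaluation {X Y₁ Y₂ : C} (p₁ : ExactPairing X Y₁)
    (p₂ : ExactPairing X Y₂) :
    (rightDualIso p₁ p₂).hom ▷ X ≫ p₂.evaluation' = p₁.evaluation' := by
  have h := @rightAdjointMate_comp_evaluation C _ _ X X ⟨Y₂⟩ ⟨Y₁⟩ (𝟙 X)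
  rw [MonoidalCategory.whiskerLeft_id, Category.id_comp] at h
  exact h

/-- Nested evaluation `X ⊗ Y ⊗ Y' ⊗ X' ⟶ 𝟙`. -/
def nest {X X' Y Y' : C} (e : X ⊗ X' ⟶ 𝟙_ C) (e' : Y ⊗ Y' ⟶ 𝟙_ C) :
    (X ⊗ Y) ⊗ (Y' ⊗ X') ⟶ 𝟙_ C :=
  𝟙 _ ⊗≫ X ◁ e' ▷ X' ⊗≫ e

theorem nest_natural {X X₁ X' Y Y₁ Y' : C} (f : X ⟶ X₁) (g : Y ⟶ Y₁)
    (e : X₁ ⊗ X' ⟶ 𝟙_ C) (e' : Y₁ ⊗ Y' ⟶ 𝟙_ C) :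
    (f ⊗ₘ g) ▷ (Y' ⊗ X') ≫ nest e e' = nest (f ▷ X' ≫ e) (g ▷ Y' ≫ e') := by
  calc
    _ = 𝟙 _ ⊗≫ (f ▷ (Y ⊗ Y') ≫ X₁ ◁ (g ▷ Y' ≫ e')) ▷ X' ⊗≫ e := by
      dsimp only [nest]; rw [MonoidalCategory.tensorHom_def]; monoidal
    _ = _ := by
      rw [← whisker_exchange]; dsimp only [nest]; monoidal

theorem rightDualIso_hom_coevaluation {X Y₁ Y₂ : C} (p₁ : ExactPairing X Y₁)
    (p₂ : ExactPairing X Y₂) :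
    p₁.coevaluation' ≫ X ◁ (rightDualIso p₁ p₂).hom = p₂.coevaluation' := by
  have h := @coevaluation_comp_rightAdjointMate C _ _ X X ⟨Y₂⟩ ⟨Y₁⟩ (𝟙 X)
  rw [id_whiskerRight, Category.comp_id] at h
  exact h

variable [RightRigidCategory C]

/-- `Xᵛᵛ ⊗ Yᵛᵛ` is a dual of `(X ⊗ Y)ᵛ`, through `(X ⊗ Y)ᵛ ≅ Yᵛ ⊗ Xᵛ`. -/
abbrev tensorDoubleDualPairing (X Y : C) : ExactPairing ((X ⊗ Y)ᵛ : C) (Xᵛᵛ ⊗ Yᵛᵛ : C) :=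
  letI : ExactPairing (Yᵛ ⊗ Xᵛ : C) (Xᵛᵛ ⊗ Yᵛᵛ : C) := ExactPairing.tensor
  exactPairingCongrLeft (rightDualTensorIso X Y)

/-- The monoidal structure `(X ⊗ Y)ᵛᵛ ≅ Xᵛᵛ ⊗ Yᵛᵛ` of the double dual functor. -/
def doubleDualTensorIso (X Y : C) : ((X ⊗ Y)ᵛᵛ : C) ≅ (Xᵛᵛ ⊗ Yᵛᵛ : C) :=
  rightDualIso HasRightDual.exact (tensorDoubleDualPairing X Y)

theorem nest_eq_tensor (X Y : C) : 
  nest (ε_ Y Yᵛ) (ε_ X Xᵛ) = ε_ (X ⊗ Y) (Yᵛ ⊗ Xᵛ) := by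
  rw [ExactPairing.tensor_evaluation, nest]

theorem rightDualTensorIso_hom_evaluation (X Y : C) :
    (rightDualTensorIso X Y).hom ▷ (X ⊗ Y) ≫ nest (ε_ Y Yᵛ) (ε_ X Xᵛ) = ε_ (X ⊗ Y) (X ⊗ Y)ᵛ := by
  rw [nest_eq_tensor]
  exact rightDualIso_hom_evaluation _ _

theorem doubleDualTensorIso_hom_evaluation (X Y : C) :
    (doubleDualTensorIso X Y).hom ▷ (X ⊗ Y)ᵛ ≫ (Xᵛᵛ ⊗ Yᵛᵛ : C) ◁ (rightDualTensorIso X Y).hom ≫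
      nest (ε_ Xᵛ Xᵛᵛ) (ε_ Yᵛ Yᵛᵛ) = ε_ (X ⊗ Y)ᵛ (X ⊗ Y)ᵛᵛ := by
  rw [nest_eq_tensor]
  exact rightDualIso_hom_evaluation HasRightDual.exact (tensorDoubleDualPairing X Y)

end Duals

section Pivotal

variable (C : Type u) [Category.{v} C] [MonoidalCategory C]

/-- A pivotal structure on a rigid monoidal category: a natural isomorphism of monoidal functors
`j : 𝟭 ≅ (-)ᵛᵛ`. The dual `Xᵛ` is the one with an evaluation `Xᵛ ⊗ X ⟶ 𝟙` and a coevaluation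
`𝟙 ⟶ X ⊗ Xᵛ`, and `fᵗ` is the dual of the morphism `f`. -/
class PivotalCategory [RightRigidCategory C] where
  pivot : ∀ X : C, X ≅ (Xᵛᵛ : C)
  pivot_naturality : ∀ {X Y : C} (f : X ⟶ Y), f ≫ (pivot Y).hom = (pivot X).hom ≫ (fᵗ)ᵗ
  pivot_tensor : ∀ X Y : C,
    (pivot (X ⊗ Y)).hom ≫ (doubleDualTensorIso X Y).hom = ((pivot X).hom ⊗ₘ (pivot Y).hom)

variable {C}
variable [RightRigidCategory C] [PivotalCategory C]
open PivotalCategory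

/-- The left pivotal trace of `f : X ⟶ X`, an endomorphism of the unit:
`𝟙 ⟶ Xᵛ ⊗ Xᵛᵛ ⟶ Xᵛ ⊗ X ⟶ Xᵛ ⊗ X ⟶ 𝟙`, the second arrow being `j⁻¹` and the third one `f`. -/
def leftTrace {X : C} (f : X ⟶ X) : 𝟙_ C ⟶ 𝟙_ C :=
  η_ Xᵛ Xᵛᵛ ≫ Xᵛ ◁ (pivot X).inv ≫ Xᵛ ◁ f ≫ ε_ X Xᵛ

/-- The evaluation `X ⊗ Xᵛ ⟶ 𝟙` given by the pivotal structure. -/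
def pev (X : C) : X ⊗ Xᵛ ⟶ 𝟙_ C := (pivot X).hom ▷ Xᵛ ≫ ε_ Xᵛ Xᵛᵛ

/-- In a pivotal category `X` is a dual of `Xᵛ`. -/
abbrev pivotalPairing (X : C) : ExactPairing (Xᵛ : C) X := exactPairingCongrRight (pivot X)

theorem pev_natural {X Y : C} (f : X ⟶ Y) : f ▷ Yᵛ ≫ pev Y = X ◁ fᵗ ≫ pev X := by
  rw [pev, ← comp_whiskerRight_assoc, pivot_naturality, comp_whiskerRight_assoc,
    rightAdjointMate_comp_evaluation, ← whisker_exchange_assoc, pev]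

theorem pev_tensor (X Y : C) :
    (X ⊗ Y) ◁ (rightDualTensorIso X Y).inv ≫ pev (X ⊗ Y) = nest (pev X) (pev Y) := by
  rw [pev, ← doubleDualTensorIso_hom_evaluation, ← comp_whiskerRight_assoc, pivot_tensor,
    whisker_exchange_assoc, ← MonoidalCategory.whiskerLeft_comp_assoc, Iso.inv_hom_id,
    MonoidalCategory.whiskerLeft_id, Category.id_comp, nest_natural]
  rfl

end Pivotal

section CenterRigid

variable {C : Type u} [Category.{v} C] [MonoidalCategory C]

theorem halfBraiding_inv_tensor {X : C} (b : HalfBraiding X) (U V : C) :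
    (b.β (U ⊗ V)).inv = (α_ U V X).hom ≫ U ◁ (b.β V).inv ≫ (α_ U X V).inv ≫
      (b.β U).inv ▷ V ≫ (α_ X U V).hom := by
  have h : (b.β (U ⊗ V)).hom ≫ ((α_ U V X).hom ≫ U ◁ (b.β V).inv ≫ (α_ U X V).inv ≫
      (b.β U).inv ▷ V ≫ (α_ X U V).hom) = 𝟙 _ := by
    rw [b.monoidal]; simp
  rw [← cancel_epi (b.β (U ⊗ V)).hom, h, Iso.hom_inv_id]

theorem halfBraiding_inv_naturality {X : C} (b : HalfBraiding X) {U V : C} (f : U ⟶ V) :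
    f ▷ X ≫ (b.β V).inv = (b.β U).inv ≫ X ◁ f := by
  rw [Iso.comp_inv_eq, Category.assoc, b.naturality, Iso.inv_hom_id_assoc]

theorem halfBraiding_unit_hom {X : C} (b : HalfBraiding X) :
    (b.β (𝟙_ C)).hom = (ρ_ X).hom ≫ (λ_ X).inv := by
  let Z : Center C := ⟨X, b⟩
  have h := congrArg Center.Hom.f (CategoryTheory.braiding_tensorUnit_right Z)
  rw [Center.comp_f, Center.rightUnitor_hom_f, Center.leftUnitor_inv_f] at h
  exact h

theorem halfBraiding_unit_inv {X : C} (b : HalfBraiding X) :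
    (b.β (𝟙_ C)).inv = (λ_ X).hom ≫ (ρ_ X).inv := by
  rw [← cancel_epi (b.β (𝟙_ C)).hom, Iso.hom_inv_id, halfBraiding_unit_hom]
  simp

variable [RightRigidCategory C] [PivotalCategory C]

/-- The half-braiding on `Xᵛ` for an object `X` of the Drinfeld center. -/
def dualHalfBraiding (X : Center C) : HalfBraiding (X.1ᵛ) where
  β U :=
    letI := pivotalPairing U
    { hom := dualMate (X.1ᵛ) (X.2.β U).inv
      inv := crossInv (dualMate (X.1ᵛ) (X.2.β (Uᵛ)).inv)
      hom_inv_id := cross_crossInv (σ := fun U => dualMate (X.1ᵛ) (X.2.β U).inv)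
        (fun f => dualMate_natural f _ _ (halfBraiding_inv_naturality X.2 f))
        (fun U V => by rw [halfBraiding_inv_tensor, dualMate_tensor])
        (by rw [halfBraiding_unit_inv, dualMate_unit])
      inv_hom_id := crossInv_cross (σ := fun U => dualMate (X.1ᵛ) (X.2.β U).inv)
        (fun f => dualMate_natural f _ _ (halfBraiding_inv_naturality X.2 f))
        (fun U V => by rw [halfBraiding_inv_tensor, dualMate_tensor])
        (by rw [halfBraiding_unit_inv, dualMate_unit]) }
  monoidal U V := by
    dsimp only
    rw [halfBraiding_inv_tensor, dualMate_tensor]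
  naturality f := dualMate_natural f _ _ (halfBraiding_inv_naturality X.2 f)

/-- The dual of an object of the Drinfeld center. -/
def centerDual (X : Center C) : Center C := ⟨X.1ᵛ, dualHalfBraiding X⟩

/-- The coevaluation of `C` is a morphism of the Drinfeld center. -/
def centerCoevaluation (X : Center C) : 𝟙_ (Center C) ⟶ X ⊗ centerDual X where
  f := η_ X.1 (X.1ᵛ)
  comm U := by
    change η_ X.1 (X.1ᵛ) ▷ U ≫ ((α_ _ _ _).hom ≫ X.1 ◁ dualMate (X.1ᵛ) (X.2.β U).inv ≫
      (α_ _ _ _).inv ≫ (X.2.β U).hom ▷ X.1ᵛ ≫ (α_ _ _ _).hom) =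
      ((λ_ U).hom ≫ (ρ_ U).inv) ≫ U ◁ η_ X.1 (X.1ᵛ)
    calc
      _ = (η_ X.1 (X.1ᵛ) ▷ U ⊗≫ X.1 ◁ dualMate (X.1ᵛ) (X.2.β U).inv) ⊗≫
          (X.2.β U).hom ▷ X.1ᵛ ⊗≫ 𝟙 _ := by monoidal
      _ = 𝟙 _ ⊗≫ U ◁ η_ X.1 (X.1ᵛ) ⊗≫ ((X.2.β U).inv ≫ (X.2.β U).hom) ▷ X.1ᵛ ⊗≫ 𝟙 _ := by
        rw [coevaluation_dualMate]; monoidal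
      _ = _ := by rw [Iso.inv_hom_id]; monoidal

/-- The evaluation of `C` is a morphism of the Drinfeld center. -/
def centerEvaluation (X : Center C) : centerDual X ⊗ X ⟶ 𝟙_ (Center C) where
  f := ε_ X.1 (X.1ᵛ)
  comm U := by
    change ε_ X.1 (X.1ᵛ) ▷ U ≫ ((λ_ U).hom ≫ (ρ_ U).inv) =
      ((α_ _ _ _).hom ≫ X.1ᵛ ◁ (X.2.β U).hom ≫ (α_ _ _ _).inv ≫
        dualMate (X.1ᵛ) (X.2.β U).inv ▷ X.1 ≫ (α_ _ _ _).hom) ≫ U ◁ ε_ X.1 (X.1ᵛ)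
    symm
    calc
      _ = 𝟙 _ ⊗≫ X.1ᵛ ◁ (X.2.β U).hom ⊗≫ (dualMate (X.1ᵛ) (X.2.β U).inv ▷ X.1 ⊗≫
          U ◁ ε_ X.1 (X.1ᵛ)) := by monoidal
      _ = 𝟙 _ ⊗≫ X.1ᵛ ◁ ((X.2.β U).hom ≫ (X.2.β U).inv) ⊗≫ ε_ X.1 (X.1ᵛ) ▷ U ⊗≫ 𝟙 _ := by
        rw [dualMate_evaluation]; monoidal
      _ = _ := by rw [Iso.hom_inv_id]; monoidal

instance centerExactPairing (X : Center C) : ExactPairing X (centerDual X) where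
  coevaluation' := centerCoevaluation X
  evaluation' := centerEvaluation X
  coevaluation_evaluation' := by
    refine Center.ext _ _ ?_
    simp only [Center.comp_f, Center.whiskerLeft_f, Center.whiskerRight_f,
      Center.associator_inv_f, Center.leftUnitor_inv_f, Center.rightUnitor_hom_f]
    exact ExactPairing.coevaluation_evaluation X.1 (X.1ᵛ)
  evaluation_coevaluation' := by
    refine Center.ext _ _ ?_
    simp only [Center.comp_f, Center.whiskerLeft_f, Center.whiskerRight_f,
      Center.associator_hom_f, Center.leftUnitor_hom_f, Center.rightUnitor_inv_f]
    exact ExactPairing.evaluation_coevaluation X.1 (X.1ᵛ)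

/-- Duals in the Drinfeld center lie over the duals in `C`. -/
instance centerRightRigid : RightRigidCategory (Center C) where
  rightDual X := { rightDual := centerDual X }

end CenterRigid

section CenterPivotal

variable {C : Type u} [Category.{v} C] [MonoidalCategory C]

theorem leftDual_hom_ext {X Y Z : C} [ExactPairing X Y] {f g : Z ⟶ X}
    (h : Y ◁ f ≫ ε_ X Y = Y ◁ g ≫ ε_ X Y) : f = g := by
  let _ : HasLeftDual Y := ⟨X⟩
  have key : ∀ k : Z ⟶ X, tensorLeftHomEquiv Z X Y (𝟙_ C) (Y ◁ k ≫ ε_ X Y) = k ≫ (ρ_ X).inv :=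
    fun k => tensorLeftHomEquiv_whiskerLeft_comp_evaluation (Z := Y) k
  have := key f
  rw [h, key g] at this
  exact ((cancel_mono _).1 this).symm

theorem halfBraiding_cross {X : C} (b : HalfBraiding X) {W V : C} (e : W ⊗ V ⟶ 𝟙_ C) :
    (b.β W).hom ▷ V ⊗≫ W ◁ (b.β V).hom ⊗≫ e ▷ X = 𝟙 _ ⊗≫ X ◁ e ⊗≫ 𝟙 _ := by
  have h := b.naturality e
  rw [b.monoidal, halfBraiding_unit_hom] at h
  calc
    _ = (α_ _ _ _).hom ≫ (((α_ X W V).inv ≫ (b.β W).hom ▷ V ≫ (α_ W X V).hom ≫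
      W ◁ (b.β V).hom ≫ (α_ W V X).inv) ≫ e ▷ X) := by monoidal
    _ = _ := by rw [← h]; monoidal

theorem halfBraiding_cap {X : C} (b : HalfBraiding X) {W V : C} (e : W ⊗ V ⟶ 𝟙_ C) :
    W ◁ (b.β V).hom ⊗≫ e ▷ X = 𝟙 _ ⊗≫ (b.β W).inv ▷ V ⊗≫ X ◁ e ⊗≫ 𝟙 _ := by
  calc
    _ = 𝟙 _ ⊗≫ ((b.β W).inv ≫ (b.β W).hom) ▷ V ⊗≫ W ◁ (b.β V).hom ⊗≫ e ▷ X := by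
      rw [Iso.inv_hom_id]; monoidal
    _ = 𝟙 _ ⊗≫ (b.β W).inv ▷ V ⊗≫ ((b.β W).hom ▷ V ⊗≫ W ◁ (b.β V).hom ⊗≫ e ▷ X) := by
      monoidal
    _ = _ := by rw [halfBraiding_cross]; monoidal

theorem center_rightDualIso_f {X Y₁ Y₂ : Center C} (p₁ : ExactPairing X Y₁)
    (p₂ : ExactPairing X Y₂) (q₁ : ExactPairing X.1 Y₁.1) (q₂ : ExactPairing X.1 Y₂.1)
    (h₁ : p₁.evaluation'.f = q₁.evaluation') (h₂ : p₂.evaluation'.f = q₂.evaluation') :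
    (rightDualIso p₁ p₂).hom.f = (rightDualIso q₁ q₂).hom := by
  apply rightDual_hom_ext (X := X.1)
  refine Eq.trans ?_ (rightDualIso_hom_evaluation q₁ q₂).symm
  have h := congrArg Center.Hom.f (rightDualIso_hom_evaluation p₁ p₂)
  rw [Center.comp_f, Center.whiskerRight_f, h₁, h₂] at h
  exact h

theorem center_nest_f {X X' Y Y' : Center C} (e : X ⊗ X' ⟶ 𝟙_ (Center C))
    (e' : Y ⊗ Y' ⟶ 𝟙_ (Center C)) : (nest e e').f = nest (C := C) e.f e'.f := by
  simp [nest, monoidalComp]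
  rfl

variable [RightRigidCategory C]

theorem rightDualTensorIso_inv_evaluation (X Y : C) :
    (rightDualTensorIso X Y).inv ▷ (X ⊗ Y) ≫ ε_ (X ⊗ Y) ((X ⊗ Y)ᵛ) =
      nest (ε_ Y (Yᵛ)) (ε_ X (Xᵛ)) := by
  rw [← rightDualTensorIso_hom_evaluation, ← comp_whiskerRight_assoc, Iso.inv_hom_id,
    id_whiskerRight, Category.id_comp]

theorem dualMate_nest (X : Center C) (V : C) :
    dualMate (X.1ᵛ) (X.2.β (Vᵛ)).inv ▷ (X.1 ⊗ V) ≫ nest (ε_ V (Vᵛ)) (ε_ X.1 (X.1ᵛ)) =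
      (X.1ᵛ ⊗ Vᵛ) ◁ (X.2.β V).hom ≫ nest (ε_ X.1 (X.1ᵛ)) (ε_ V (Vᵛ)) := by
  calc
    _ = 𝟙 _ ⊗≫ (dualMate (X.1ᵛ) (X.2.β (Vᵛ)).inv ▷ X.1 ⊗≫ Vᵛ ◁ ε_ X.1 (X.1ᵛ)) ▷ V ⊗≫
        ε_ V (Vᵛ) := by
      dsimp only [nest]; monoidal
    _ = 𝟙 _ ⊗≫ X.1ᵛ ◁ (X.2.β (Vᵛ)).inv ▷ V ⊗≫
        (ε_ X.1 (X.1ᵛ) ▷ (Vᵛ ⊗ V) ≫ 𝟙_ C ◁ ε_ V (Vᵛ)) ⊗≫ 𝟙 _ := by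
      rw [dualMate_evaluation]; monoidal
    _ = 𝟙 _ ⊗≫ X.1ᵛ ◁ (𝟙 (Vᵛ ⊗ X.1 ⊗ V) ⊗≫ (X.2.β (Vᵛ)).inv ▷ V ⊗≫
        X.1 ◁ ε_ V (Vᵛ) ⊗≫ 𝟙 (𝟙_ C ⊗ X.1)) ⊗≫
        ε_ X.1 (X.1ᵛ) := by
      rw [← whisker_exchange]; monoidal
    _ = _ := by
      rw [← halfBraiding_cap]; dsimp only [nest]; monoidal

theorem rightAdjointMate_halfBraiding (X : Center C) (V : C) :
    (rightDualTensorIso V X.1).inv ≫ ((X.2.β V).hom)ᵗ =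
      dualMate (X.1ᵛ) (X.2.β (Vᵛ)).inv ≫ (rightDualTensorIso X.1 V).inv := by
  apply rightDual_hom_ext (X := X.1 ⊗ V)
  rw [comp_whiskerRight_assoc, rightAdjointMate_comp_evaluation, ← whisker_exchange_assoc,
    rightDualTensorIso_inv_evaluation, comp_whiskerRight_assoc,
    rightDualTensorIso_inv_evaluation, dualMate_nest]

variable [PivotalCategory C]
open PivotalCategory

theorem halfBraiding_nest_pev (X : Center C) (V : C) :
    (X.2.β V).hom ▷ (X.1ᵛ ⊗ Vᵛ) ≫ nest (pev V) (pev X.1) =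
      (X.1 ⊗ V) ◁ dualMate (X.1ᵛ) (X.2.β (Vᵛ)).inv ≫ nest (pev X.1) (pev V) := by
  rw [← pev_tensor, ← whisker_exchange_assoc, pev_natural,
    ← MonoidalCategory.whiskerLeft_comp_assoc, rightAdjointMate_halfBraiding,
    MonoidalCategory.whiskerLeft_comp_assoc, pev_tensor]

theorem pev_cross_dual (X : Center C) (V : C) :
    X.1 ◁ dualMate (X.1ᵛ) (X.2.β (Vᵛ)).inv ⊗≫ (X.2.β (Vᵛ)).hom ▷ X.1ᵛ ⊗≫ Vᵛ ◁ pev X.1 =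
      𝟙 _ ⊗≫ pev X.1 ▷ Vᵛ ⊗≫ 𝟙 _ := by
  let _ := pivotalPairing V
  rw [← cancel_mono (ρ_ (Vᵛ)).hom]
  apply leftDual_hom_ext (X := Vᵛ) (Y := V)
  change _ ≫ pev V = _ ≫ pev V
  calc
    _ = 𝟙 _ ⊗≫ V ◁ (X.1 ◁ dualMate (X.1ᵛ) (X.2.β (Vᵛ)).inv) ⊗≫ V ◁ (X.2.β (Vᵛ)).hom ▷ X.1ᵛ ⊗≫
        ((V ⊗ Vᵛ) ◁ pev X.1 ≫ pev V ▷ 𝟙_ C) ⊗≫ 𝟙 _ := by monoidal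
    _ = 𝟙 _ ⊗≫ V ◁ (X.1 ◁ dualMate (X.1ᵛ) (X.2.β (Vᵛ)).inv) ⊗≫
        (V ◁ (X.2.β (Vᵛ)).hom ⊗≫ pev V ▷ X.1) ▷ X.1ᵛ ⊗≫ pev X.1 := by
      rw [whisker_exchange]; monoidal
    _ = 𝟙 _ ⊗≫ ((V ⊗ X.1) ◁ dualMate (X.1ᵛ) (X.2.β (Vᵛ)).inv ≫
        (X.2.β V).inv ▷ (Vᵛ ⊗ X.1ᵛ)) ⊗≫ X.1 ◁ pev V ▷ X.1ᵛ ⊗≫ pev X.1 := by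
      rw [halfBraiding_cap]; monoidal
    _ = 𝟙 _ ⊗≫ (X.2.β V).inv ▷ (X.1ᵛ ⊗ Vᵛ) ⊗≫
        ((X.1 ⊗ V) ◁ dualMate (X.1ᵛ) (X.2.β (Vᵛ)).inv ≫ nest (pev X.1) (pev V)) := by
      rw [whisker_exchange]; dsimp only [nest]; monoidal
    _ = 𝟙 _ ⊗≫ ((X.2.β V).inv ≫ (X.2.β V).hom) ▷ (X.1ᵛ ⊗ Vᵛ) ⊗≫ nest (pev V) (pev X.1) := by
      rw [← halfBraiding_nest_pev]; monoidal
    _ = _ := by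
      rw [Iso.inv_hom_id]; dsimp only [nest]; monoidal

theorem pev_cross (X : Center C) (U : C) :
    X.1 ◁ dualMate (X.1ᵛ) (X.2.β U).inv ⊗≫ (X.2.β U).hom ▷ X.1ᵛ ⊗≫ U ◁ pev X.1 =
      𝟙 _ ⊗≫ pev X.1 ▷ U ⊗≫ 𝟙 _ := by
  have hn := dualMate_natural (Y := X.1ᵛ) (pivot U).hom _ _
    (halfBraiding_inv_naturality X.2 (pivot U).hom)
  have hb := X.2.naturality (pivot U).hom
  have h := pev_cross_dual X (Uᵛ)
  rw [← cancel_mono ((ρ_ U).hom ≫ (pivot U).hom)]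
  calc
    _ = 𝟙 _ ⊗≫ X.1 ◁ dualMate (X.1ᵛ) (X.2.β U).inv ⊗≫ (X.2.β U).hom ▷ X.1ᵛ ⊗≫
        (U ◁ pev X.1 ≫ (pivot U).hom ▷ 𝟙_ C) ⊗≫ 𝟙 _ := by monoidal
    _ = 𝟙 _ ⊗≫ X.1 ◁ dualMate (X.1ᵛ) (X.2.β U).inv ⊗≫
        ((X.2.β U).hom ≫ (pivot U).hom ▷ X.1) ▷ X.1ᵛ ⊗≫ Uᵛᵛ ◁ pev X.1 ⊗≫ 𝟙 _ := by
      rw [whisker_exchange]; monoidal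
    _ = 𝟙 _ ⊗≫ X.1 ◁ (dualMate (X.1ᵛ) (X.2.β U).inv ≫ (pivot U).hom ▷ X.1ᵛ) ⊗≫
        (X.2.β (Uᵛᵛ)).hom ▷ X.1ᵛ ⊗≫ Uᵛᵛ ◁ pev X.1 ⊗≫ 𝟙 _ := by
      rw [← hb]; monoidal
    _ = 𝟙 _ ⊗≫ (X.1 ⊗ X.1ᵛ) ◁ (pivot U).hom ⊗≫
        (X.1 ◁ dualMate (X.1ᵛ) (X.2.β (Uᵛᵛ)).inv ⊗≫ (X.2.β (Uᵛᵛ)).hom ▷ X.1ᵛ ⊗≫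
          Uᵛᵛ ◁ pev X.1) ⊗≫ 𝟙 _ := by
      rw [← hn]; monoidal
    _ = 𝟙 _ ⊗≫ ((X.1 ⊗ X.1ᵛ) ◁ (pivot U).hom ≫ pev X.1 ▷ Uᵛᵛ) ⊗≫ 𝟙 _ := by
      rw [h]; monoidal
    _ = _ := by
      rw [whisker_exchange]; monoidal

/-- The pivotal evaluation of `C` is a morphism of the Drinfeld center. -/
def centerPev (X : Center C) : X ⊗ centerDual X ⟶ 𝟙_ (Center C) where
  f := pev X.1
  comm U := by
    change pev X.1 ▷ U ≫ ((λ_ U).hom ≫ (ρ_ U).inv) =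
      ((α_ _ _ _).hom ≫ X.1 ◁ dualMate (X.1ᵛ) (X.2.β U).inv ≫ (α_ _ _ _).inv ≫
        (X.2.β U).hom ▷ X.1ᵛ ≫ (α_ _ _ _).hom) ≫ U ◁ pev X.1
    symm
    calc
      _ = 𝟙 _ ⊗≫ (X.1 ◁ dualMate (X.1ᵛ) (X.2.β U).inv ⊗≫ (X.2.β U).hom ▷ X.1ᵛ ⊗≫
          U ◁ pev X.1) := by monoidal
      _ = _ := by rw [pev_cross]; monoidal

theorem centerPev_mate (X : Center C) :
    ((ρ_ X).inv ≫ X ◁ η_ (Xᵛ) (Xᵛᵛ) ≫ (α_ _ _ _).inv ≫ centerPev X ▷ Xᵛᵛ ≫ (λ_ _).hom).f =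
      (pivot X.1).hom := by
  have h := tensorRightHomEquiv_whiskerRight_comp_evaluation (X := X.1ᵛ) (pivot X.1).hom
  have h2 : (ρ_ X.1).inv ≫ X.1 ◁ η_ (X.1ᵛ) (X.1ᵛᵛ) ≫ (α_ _ _ _).inv ≫ pev X.1 ▷ X.1ᵛᵛ =
    (pivot X.1).hom ≫ (λ_ _).inv := h
  have h3 : (ρ_ X.1).inv ≫ X.1 ◁ η_ (X.1ᵛ) (X.1ᵛᵛ) ≫ (α_ _ _ _).inv ≫ pev X.1 ▷ X.1ᵛᵛ ≫
      (λ_ _).hom = (pivot X.1).hom := by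
    rw [← cancel_mono (λ_ (X.1ᵛᵛ)).inv, ← h2]
    simp
  refine Eq.trans ?_ h3
  simp only [Center.comp_f, Center.whiskerLeft_f, Center.whiskerRight_f,
      Center.associator_inv_f, Center.leftUnitor_hom_f, Center.rightUnitor_inv_f]
  rfl

/-- The pivotal structure of `C` at (the object underlying) `X` is a morphism of the Drinfeld
center. -/
def centerPivotHom (X : Center C) : X ⟶ Xᵛᵛ where
  f := (pivot X.1).hom
  comm U := by
    rw [← centerPev_mate]
    exact Center.Hom.comm _ U

instance (X : Center C) : IsIso (centerPivotHom X).f :=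
  inferInstanceAs (IsIso (pivot X.1).hom)

theorem center_rightAdjointMate_f {X Y : Center C} (f : X ⟶ Y) : (fᵗ).f = (f.f)ᵗ := by
  simp only [rightAdjointMate, Center.comp_f, Center.whiskerLeft_f, Center.whiskerRight_f,
      Center.associator_inv_f, Center.leftUnitor_hom_f, Center.rightUnitor_inv_f]
  rfl

theorem center_rightDualTensorIso_f (X Y : Center C) :
    (rightDualTensorIso X Y).hom.f = (rightDualTensorIso X.1 Y.1).hom := by
  refine center_rightDualIso_f HasRightDual.exact
    (ExactPairing.tensor : ExactPairing (X ⊗ Y) (Yᵛ ⊗ Xᵛ))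
    (HasRightDual.exact : ExactPairing (X.1 ⊗ Y.1) ((X.1 ⊗ Y.1)ᵛ))
    (ExactPairing.tensor : ExactPairing (X.1 ⊗ Y.1) (Y.1ᵛ ⊗ X.1ᵛ)) ?_ ?_
  · rfl
  refine Eq.trans (congrArg Center.Hom.f (nest_eq_tensor X Y).symm) ?_
  rw [center_nest_f]
  exact nest_eq_tensor X.1 Y.1

theorem center_doubleDualTensorIso_f (X Y : Center C) :
    (doubleDualTensorIso X Y).hom.f = (doubleDualTensorIso X.1 Y.1).hom := by
  refine center_rightDualIso_f HasRightDual.exact (tensorDoubleDualPairing X Y)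
    (HasRightDual.exact : ExactPairing ((X.1 ⊗ Y.1)ᵛ) ((X.1 ⊗ Y.1)ᵛᵛ))
    (tensorDoubleDualPairing X.1 Y.1) ?_ ?_
  · rfl
  change (_ ◁ (rightDualTensorIso X Y).hom ≫ ε_ (Yᵛ ⊗ Xᵛ) (Xᵛᵛ ⊗ Yᵛᵛ)).f =
    _ ◁ (rightDualTensorIso X.1 Y.1).hom ≫ ε_ (Y.1ᵛ ⊗ X.1ᵛ) (X.1ᵛᵛ ⊗ Y.1ᵛᵛ)
  rw [← nest_eq_tensor, ← nest_eq_tensor, ← center_rightDualTensorIso_f, Center.comp_f,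
    center_nest_f]
  rfl

/-- The pivotal structure of the Drinfeld center inherited from `C`: the morphism of `C`
underlying `pivot X` is `pivot X.1`. -/
instance centerPivotal : PivotalCategory (Center C) where
  pivot X := Center.isoMk (centerPivotHom X)
  pivot_naturality {X Y} f := by
    refine Center.ext _ _ ?_
    change f.f ≫ (pivot Y.1).hom = (pivot X.1).hom ≫ ((fᵗ)ᵗ).f
    rw [center_rightAdjointMate_f, center_rightAdjointMate_f, pivot_naturality]
    rfl
  pivot_tensor X Y := by
    refine Center.ext _ _ ?_
    change (pivot (X.1 ⊗ Y.1)).hom ≫ (doubleDualTensorIso X Y).hom.f = (pivot X.1).hom ⊗ₘ (pivot Y.1).hom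
    rw [center_doubleDualTensorIso_f]
    exact pivot_tensor X.1 Y.1

end CenterPivotal

section Symmetric

variable {C : Type u} [Category.{v} C] [MonoidalCategory C]
open BraidedCategory PivotalCategory

theorem braiding_nest [SymmetricCategory C] {X X' Y Y' : C} (e : X' ⊗ X ⟶ 𝟙_ C)
    (e' : Y' ⊗ Y ⟶ 𝟙_ C) :
    (β_ (X ⊗ Y) (Y' ⊗ X')).hom ≫ nest e' e =
      nest ((β_ X X').hom ≫ e) ((β_ Y Y').hom ≫ e') := by
  have k1 : X ◁ (β_ Y X').hom ⊗≫ ((β_ X X').hom ≫ e) ▷ Y =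
      𝟙 _ ⊗≫ (β_ X Y).hom ▷ X' ⊗≫ Y ◁ ((β_ X X').hom ≫ e) ⊗≫ 𝟙 _ := by
    rw [SymmetricCategory.braiding_swap_eq_inv_braiding Y X]
    exact halfBraiding_cap (Center.ofBraidedObj Y).2 ((β_ X X').hom ≫ e)
  have k2 : (β_ X Y').hom ▷ Y ⊗≫ Y' ◁ (β_ X Y).hom ⊗≫ e' ▷ X = 𝟙 _ ⊗≫ X ◁ e' ⊗≫ 𝟙 _ :=
    halfBraiding_cross (Center.ofBraidedObj X).2 e'
  calc
    _ = 𝟙 _ ⊗≫ X ◁ (β_ Y Y').hom ▷ X' ⊗≫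
        ((X ⊗ Y') ◁ (β_ Y X').hom ≫ (β_ X Y').hom ▷ (X' ⊗ Y)) ⊗≫
        Y' ◁ ((β_ X X').hom ≫ e) ▷ Y ⊗≫ e' := by
      rw [braiding_tensor_left_hom, braiding_tensor_right_hom, braiding_tensor_right_hom]
      dsimp only [nest]; monoidal
    _ = 𝟙 _ ⊗≫ X ◁ (β_ Y Y').hom ▷ X' ⊗≫ (β_ X Y').hom ▷ (Y ⊗ X') ⊗≫
        Y' ◁ (X ◁ (β_ Y X').hom ⊗≫ ((β_ X X').hom ≫ e) ▷ Y) ⊗≫ e' := by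
      rw [whisker_exchange]; monoidal
    _ = 𝟙 _ ⊗≫ X ◁ (β_ Y Y').hom ▷ X' ⊗≫ (β_ X Y').hom ▷ (Y ⊗ X') ⊗≫
        Y' ◁ (β_ X Y).hom ▷ X' ⊗≫ ((Y' ⊗ Y) ◁ ((β_ X X').hom ≫ e) ≫ e' ▷ 𝟙_ C) ⊗≫ 𝟙 _ := by
      rw [k1]; monoidal
    _ = 𝟙 _ ⊗≫ X ◁ (β_ Y Y').hom ▷ X' ⊗≫
        ((β_ X Y').hom ▷ Y ⊗≫ Y' ◁ (β_ X Y).hom ⊗≫ e' ▷ X) ▷ X' ⊗≫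
        ((β_ X X').hom ≫ e) := by
      rw [whisker_exchange]; monoidal
    _ = _ := by
      rw [k2]; dsimp only [nest]; monoidal

variable [RightRigidCategory C]

/-- The Drinfeld isomorphism `u : X ⟶ Xᵛᵛ` of a braided rigid category,
`X ⟶ X ⊗ Xᵛ ⊗ Xᵛᵛ ⟶ Xᵛ ⊗ X ⊗ Xᵛᵛ ⟶ Xᵛᵛ` (coevaluation of `Xᵛ`, braiding, evaluation of `X`).
It is the comparison between two duals of `Xᵛ`: the object `X`, with the evaluation
`X ⊗ Xᵛ ⟶ Xᵛ ⊗ X ⟶ 𝟙`, and the object `Xᵛᵛ`. -/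
def drinfeldIso [BraidedCategory C] (X : C) : X ≅ (Xᵛᵛ : C) :=
  rightDualIso (exactPairing_swap X (Xᵛ)) HasRightDual.exact

theorem drinfeldIso_evaluation [BraidedCategory C] (X : C) :
    (drinfeldIso X).hom ▷ Xᵛ ≫ ε_ (Xᵛ) (Xᵛᵛ) = (β_ X (Xᵛ)).hom ≫ ε_ X (Xᵛ) :=
  rightDualIso_hom_evaluation (exactPairing_swap X (Xᵛ)) HasRightDual.exact

theorem drinfeldIso_naturality [BraidedCategory C] {X Y : C} (f : X ⟶ Y) :
    f ≫ (drinfeldIso Y).hom = (drinfeldIso X).hom ≫ (fᵗ)ᵗ := by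
  apply rightDual_hom_ext (X := Yᵛ)
  rw [comp_whiskerRight_assoc, drinfeldIso_evaluation, braiding_naturality_left_assoc,
    comp_whiskerRight_assoc, rightAdjointMate_comp_evaluation, ← whisker_exchange_assoc,
    drinfeldIso_evaluation, braiding_naturality_right_assoc, rightAdjointMate_comp_evaluation]

theorem drinfeldIso_tensor [SymmetricCategory C] (X Y : C) :
    (drinfeldIso (X ⊗ Y)).hom ≫ (doubleDualTensorIso X Y).hom =
      ((drinfeldIso X).hom ⊗ₘ (drinfeldIso Y).hom) := by
  let _ := tensorDoubleDualPairing X Y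
  apply rightDual_hom_ext (X := (X ⊗ Y)ᵛ)
  have h : ε_ ((X ⊗ Y)ᵛ) (Xᵛᵛ ⊗ Yᵛᵛ) = (Xᵛᵛ ⊗ Yᵛᵛ : C) ◁ (rightDualTensorIso X Y).hom ≫
      nest (ε_ (Xᵛ) (Xᵛᵛ)) (ε_ (Yᵛ) (Yᵛᵛ)) := by
    rw [nest_eq_tensor]; rfl
  rw [h, comp_whiskerRight_assoc, doubleDualTensorIso_hom_evaluation, drinfeldIso_evaluation,
    ← whisker_exchange_assoc, nest_natural, drinfeldIso_evaluation, drinfeldIso_evaluation,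
    ← braiding_nest, braiding_naturality_right_assoc, rightDualTensorIso_hom_evaluation]

/-- In a symmetric category the Drinfeld isomorphism is a pivotal structure. It is the one whose
twist is the identity. -/
abbrev symmetricPivotal (C : Type u) [Category.{v} C] [MonoidalCategory C] [RightRigidCategory C]
    [SymmetricCategory C] : PivotalCategory C where
  pivot := drinfeldIso
  pivot_naturality := drinfeldIso_naturality
  pivot_tensor := drinfeldIso_tensor

/-- A pivotal structure is spherical if every object has the same dimension as its dual. -/
class SphericalCategory (C : Type u) [Category.{v} C] [MonoidalCategory C] [RightRigidCategory C]
    [PivotalCategory C] : Prop where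
  leftTrace_dual : ∀ X : C, leftTrace (𝟙 (Xᵛ)) = leftTrace (𝟙 X)

theorem drinfeldIso_coevaluation [BraidedCategory C] (X : C) :
    η_ (Xᵛ) (Xᵛᵛ) ≫ Xᵛ ◁ (drinfeldIso X).inv = η_ X (Xᵛ) ≫ (β_ (Xᵛ) X).inv := by
  have h : (η_ X (Xᵛ) ≫ (β_ (Xᵛ) X).inv) ≫ Xᵛ ◁ (drinfeldIso X).hom = η_ (Xᵛ) (Xᵛᵛ) :=
    rightDualIso_hom_coevaluation (exactPairing_swap X (Xᵛ)) HasRightDual.exact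
  rw [← h, Category.assoc, ← MonoidalCategory.whiskerLeft_comp, Iso.hom_inv_id,
    MonoidalCategory.whiskerLeft_id, Category.comp_id]

theorem symmetricSpherical [SymmetricCategory C] :
    @SphericalCategory C _ _ _ (symmetricPivotal C) :=
  @SphericalCategory.mk C _ _ _ (symmetricPivotal C) fun X => by
    have h := drinfeldIso_coevaluation X
    have h1 := drinfeldIso_coevaluation (Xᵛ)
    have h2 : η_ (Xᵛ) (Xᵛᵛ) = η_ X (Xᵛ) ≫ (β_ (Xᵛ) X).inv ≫ Xᵛ ◁ (drinfeldIso X).hom := by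
      rw [← reassoc_of% h, ← MonoidalCategory.whiskerLeft_comp]; simp
    change η_ (Xᵛᵛ) (Xᵛᵛᵛ) ≫ Xᵛᵛ ◁ (drinfeldIso (Xᵛ)).inv ≫ Xᵛᵛ ◁ 𝟙 (Xᵛ) ≫ ε_ (Xᵛ) (Xᵛᵛ) =
      η_ (Xᵛ) (Xᵛᵛ) ≫ Xᵛ ◁ (drinfeldIso X).inv ≫ Xᵛ ◁ 𝟙 X ≫ ε_ X (Xᵛ)
    rw [reassoc_of% h, reassoc_of% h1, h2]
    simp only [MonoidalCategory.whiskerLeft_id, Category.id_comp, Category.assoc]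
    rw [← SymmetricCategory.braiding_swap_eq_inv_braiding (Xᵛᵛ) (Xᵛ),
      braiding_naturality_right_assoc, drinfeldIso_evaluation]
    simp

theorem center_leftTrace_f [PivotalCategory C] {X : Center C} (f : X ⟶ X) :
    (leftTrace f).f = leftTrace f.f := by
  have h : (pivot X).inv.f = (pivot X.1).inv := by
    have h1 : (pivot X).hom.f ≫ (pivot X).inv.f = 𝟙 X.1 :=
      congrArg Center.Hom.f (pivot X).hom_inv_id
    exact (Iso.inv_ext h1).symm
  simp only [leftTrace, Center.comp_f, Center.whiskerLeft_f, h]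
  rfl

/-- The Drinfeld center of a spherical category is spherical. -/
instance centerSpherical [PivotalCategory C] [SphericalCategory C] :
    SphericalCategory (Center C) where
  leftTrace_dual X := by
    refine Center.ext _ _ ?_
    rw [center_leftTrace_f, center_leftTrace_f]
    exact SphericalCategory.leftTrace_dual X.1

end Symmetric

section Linear

variable {C : Type u} [Category.{v} C] [MonoidalCategory C]

theorem center_f_injective {X Y : Center C} : Function.Injective (fun f : X ⟶ Y => f.f) :=
  fun f g h => Center.ext f g h

variable [Preadditive C] [MonoidalPreadditive C]

theorem neg_whiskerRight {X Y : C} (f : X ⟶ Y) (U : C) : (-f) ▷ U = -(f ▷ U) :=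
  (tensorRight U).map_neg

theorem whiskerLeft_neg {X Y : C} (f : X ⟶ Y) (U : C) : U ◁ (-f) = -(U ◁ f) :=
  (tensorLeft U).map_neg

/-- The zero morphism of the Drinfeld center. -/
def centerHomZero (X Y : Center C) : X ⟶ Y where
  f := (0 : X.1 ⟶ Y.1)
  comm U := by
    rw [MonoidalPreadditive.zero_whiskerRight, MonoidalPreadditive.whiskerLeft_zero,
      Limits.zero_comp, Limits.comp_zero]

/-- The sum of two morphisms of the Drinfeld center. -/
def centerHomAdd {X Y : Center C} (f g : X ⟶ Y) : X ⟶ Y where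
  f := f.f + g.f
  comm U := by
    rw [MonoidalPreadditive.add_whiskerRight, MonoidalPreadditive.whiskerLeft_add,
      Preadditive.add_comp, Preadditive.comp_add, f.comm, g.comm]

/-- The negative of a morphism of the Drinfeld center. -/
def centerHomNeg {X Y : Center C} (f : X ⟶ Y) : X ⟶ Y where
  f := -f.f
  comm U := by
    rw [neg_whiskerRight, whiskerLeft_neg, Preadditive.neg_comp, Preadditive.comp_neg, f.comm]

instance centerZero (X Y : Center C) : Zero (X ⟶ Y) := ⟨centerHomZero X Y⟩

instance centerAdd (X Y : Center C) : Add (X ⟶ Y) := ⟨centerHomAdd⟩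

instance centerNeg (X Y : Center C) : Neg (X ⟶ Y) := ⟨centerHomNeg⟩

/-- Morphisms of the Drinfeld center are added in `C`. -/
instance centerPreadditive : Preadditive (Center C) where
  homGroup X Y :=
    { add_assoc f g h := Center.ext _ _ (add_assoc f.f g.f h.f)
      zero_add f := Center.ext _ _ (zero_add f.f)
      add_zero f := Center.ext _ _ (add_zero f.f)
      add_comm f g := Center.ext _ _ (add_comm f.f g.f)
      neg_add_cancel f := Center.ext _ _ (neg_add_cancel f.f)
      nsmul := nsmulRec
      zsmul := zsmulRec }
  add_comp X Y Z f g h := Center.ext _ _ (Preadditive.add_comp X.1 Y.1 Z.1 f.f g.f h.f)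
  comp_add X Y Z f g h := Center.ext _ _ (Preadditive.comp_add X.1 Y.1 Z.1 f.f g.f h.f)

variable {R : Type w} [CommRing R] [Linear R C] [MonoidalLinear R C]

/-- The multiple of a morphism of the Drinfeld center by a scalar. -/
def centerHomSMul {X Y : Center C} (r : R) (f : X ⟶ Y) : X ⟶ Y where
  f := r • f.f
  comm U := by
    rw [MonoidalLinear.smul_whiskerRight, MonoidalLinear.whiskerLeft_smul,
      Linear.smul_comp, Linear.comp_smul, f.comm]

/-- The Drinfeld center of an `R`-linear monoidal category is `R`-linear. -/
instance centerLinear : Linear R (Center C) where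
  homModule X Y :=
    { smul := centerHomSMul
      one_smul f := Center.ext _ _ (one_smul R f.f)
      mul_smul r s f := Center.ext _ _ (mul_smul r s f.f)
      smul_zero r := Center.ext _ _ (smul_zero (A := X.1 ⟶ Y.1) r)
      smul_add r f g := Center.ext _ _ (smul_add r f.f g.f)
      add_smul r s f := Center.ext _ _ (add_smul r s f.f)
      zero_smul f := Center.ext _ _ (zero_smul R f.f) }
  smul_comp X Y Z r f g := Center.ext _ _ (Linear.smul_comp X.1 Y.1 Z.1 r f.f g.f)
  comp_smul X Y Z f r g := Center.ext _ _ (Linear.comp_smul X.1 Y.1 Z.1 f.f r g.f)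

end Linear

section GaussSum

variable {C : Type u} [Category.{v} C] [MonoidalCategory C] [Preadditive C] [Linear ℂ C]
open PivotalCategory

open Classical in
/-- The complex number `c` with `f = c • 𝟙`. In a fusion category it exists, by Schur, for every
endomorphism of a simple object, in particular of the unit object. -/
def scalar {X : C} (f : X ⟶ X) : ℂ := if h : ∃ c : ℂ, f = c • 𝟙 X then h.choose else 0

variable [RightRigidCategory C] [PivotalCategory C]

/-- The (left pivotal) dimension of an object. -/
def pivotalDim (X : C) : ℂ := scalar (leftTrace (𝟙 X))

/-- The twist, or ribbon isomorphism, `θ = u⁻¹ ∘ j` of a braided pivotal category. -/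
def twist [BraidedCategory C] (X : C) : X ≅ X := pivot X ≪≫ (drinfeldIso X).symm

/-- The set of isomorphism classes of simple objects. -/
def SimpleClass (C : Type u) [Category.{v} C] [Preadditive C] : Type u :=
  { q : Quotient (isIsomorphicSetoid C) // Simple q.out }

/-- The `n`-th Gauss sum of a premodular (that is, braided spherical fusion) category:
the sum of `θ_X ^ n * dim(X) ^ 2` over representatives `X` of the isomorphism classes of simple
objects. Only the structure that the formula uses is required. -/
def gaussSum (C : Type u) [Category.{v} C] [MonoidalCategory C] [Preadditive C] [Linear ℂ C]
    [RightRigidCategory C] [PivotalCategory C] [SphericalCategory C] [BraidedCategory C]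
    (n : ℤ) : ℂ :=
  ∑ᶠ X : SimpleClass C, scalar (twist X.1.out).hom ^ n * pivotalDim X.1.out ^ 2

end GaussSum

section Rep

variable (G : Type w) [Group G]

/-- The pivotal structure of the symmetric category `Rep(G)` of finite-dimensional complex
representations: the one with trivial twist, for which the pivotal dimension is the dimension of
the underlying vector space. -/
instance repPivotal : PivotalCategory (FDRep ℂ G) := symmetricPivotal (FDRep ℂ G)

instance repSpherical : SphericalCategory (FDRep ℂ G) := symmetricSpherical

theorem rep_twist (V : FDRep ℂ G) : (twist V).hom = 𝟙 V :=
  (drinfeldIso V).hom_inv_id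

end Rep

end HigherGauss

end

/-!
# Gauss sums of the Drinfeld center of `Rep(G)`

Let `G` be a finite group and let `D(G)` be its Drinfeld double, with basis `δ_g h` for `g, h` in
`G`. The proof identifies the Gauss sum with a trace on the regular representation of `D(G)`.

A half-braiding on a representation `V` is determined, through naturality, by its value at the
regular representation and the vector `1` there. Writing `x ⊗ 1 ↦ ∑ g, g ⊗ p g x` defines
operators `p g` on `V`, and then `x ⊗ u ↦ ∑ g, g u ⊗ p g x` for all `U` and `u` in `U`
(`halfBraiding_apply`). That the braiding is monoidal and equivariant says that the `p g` are the
projections of a grading of `V` by `G` on which `G` acts by conjugation of the degrees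
(`sum_grade`, `grade_grade`, `rho_grade`), and each such grading occurs (`IsGrading.toCenter`). So
objects of the center are modules over `D(G)`, and isomorphisms and simplicity mean the same on
both sides (`isIso_iff_bijective`, `isSimpleModule_carrier`, `simple_of_isSimpleModule`).

Nondegeneracy of the evaluation shows that the Drinfeld isomorphism is the pivotal structure
preceded by the operator that acts by `g⁻¹` in degree `g` (`center_drinfeldIso_hom_f`). Hence the
twist acts by `g` in degree `g` (`lin_twist`), and its powers are the actions of the elements
`z_n = ∑ g, δ_g g ^ n` of `D(G)`. The pivotal dimension is the dimension of the underlying vector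
space (`pivotalDim_center`).

By averaging, `D(G)` is semisimple. Its isotypic components correspond to the isomorphism classes
of simple objects (`component_bijective`), so there are finitely many of them; the component of `X`
has dimension `dim(X) ^ 2` (`finrank_isotypicComponent`), and `z_n` acts on it by `θ_X ^ n`. The
Gauss sum is therefore the trace of the multiplication by `z_n` on `D(G)` (`trace_mulLeft`). This
multiplication sends `δ_g h` to `δ_g (g ^ n h)`, so its trace is the number of pairs `(g, h)` with
`g ^ n = 1` (`Double.trace_twistElt`).
-/

noncomputable section

namespace HigherGauss

open CategoryTheory MonoidalCategory PivotalCategory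
open scoped TensorProduct

universe w v u

local postfix:1024 "ᵛ" => HasRightDual.rightDual

/-! ### Linear maps underlying morphisms of representations -/

section Lin

variable {G : Type w} [Group G] {X Y Z : FDRep ℂ G}

/-- The linear map underlying a morphism of representations. -/
abbrev lin (f : X ⟶ Y) : X.V →ₗ[ℂ] Y.V := f.hom.hom.hom

/-- A pure tensor, as an element of the tensor product of two representations. -/
abbrev pureTensor (x : X.V) (y : Y.V) : (X ⊗ Y : FDRep ℂ G).V := TensorProduct.tmul ℂ x y

theorem lin_comp (f : X ⟶ Y) (g : Y ⟶ Z) (x : X.V) : lin (f ≫ g) x = lin g (lin f x) := rfl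

theorem lin_whiskerLeft (f : Y ⟶ Z) (x : X.V) (y : Y.V) :
    lin (X ◁ f) (pureTensor x y) = pureTensor x (lin f y) := rfl

theorem lin_whiskerRight (f : Y ⟶ Z) (x : X.V) (y : Y.V) :
    lin (f ▷ X) (pureTensor y x) = pureTensor (lin f y) x := rfl

theorem lin_associator_hom (x : X.V) (y : Y.V) (z : Z.V) :
    lin (α_ X Y Z).hom (pureTensor (pureTensor x y) z) = pureTensor x (pureTensor y z) := rfl

theorem lin_associator_inv (x : X.V) (y : Y.V) (z : Z.V) :
    lin (α_ X Y Z).inv (pureTensor x (pureTensor y z)) = pureTensor (pureTensor x y) z := rfl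

theorem lin_braiding (x : X.V) (y : Y.V) :
    lin (β_ X Y).hom (pureTensor x y) = pureTensor y x := rfl

theorem pureTensor_sum_right {ι : Type*} [Fintype ι] (x : X.V) (y : ι → Y.V) :
    pureTensor x (∑ i, y i) = ∑ i, pureTensor x (y i) := TensorProduct.tmul_sum _ _ _

theorem pureTensor_sum_left {ι : Type*} [Fintype ι] (x : ι → X.V) (y : Y.V) :
    pureTensor (∑ i, x i) y = ∑ i, pureTensor (x i) y := TensorProduct.sum_tmul _ _ _

theorem rho_tensor (g : G) (x : X.V) (y : Y.V) :
    (X ⊗ Y).ρ g (pureTensor x y) = pureTensor (X.ρ g x) (Y.ρ g y) := rfl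

theorem lin_rho (f : X ⟶ Y) (g : G) (x : X.V) : lin f (X.ρ g x) = Y.ρ g (lin f x) :=
  congrArg (fun h : X.V ⟶ Y.V => h.hom.hom x) (f.comm g)

theorem rho_mul_apply (X : FDRep ℂ G) (g h : G) (x : X.V) :
    X.ρ (g * h) x = X.ρ g (X.ρ h x) := by
  rw [map_mul]; rfl

theorem rho_one_apply (X : FDRep ℂ G) (x : X.V) : X.ρ 1 x = x := by
  rw [map_one]; rfl

theorem rho_inv_rho (X : FDRep ℂ G) (g : G) (x : X.V) : X.ρ g⁻¹ (X.ρ g x) = x := by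
  rw [← rho_mul_apply, inv_mul_cancel, rho_one_apply]

theorem rho_rho_inv (X : FDRep ℂ G) (g : G) (x : X.V) : X.ρ g (X.ρ g⁻¹ x) = x := by
  rw [← rho_mul_apply, mul_inv_cancel, rho_one_apply]

theorem repHom_ext {f g : X ⟶ Y} (h : ∀ x, lin f x = lin g x) : f = g :=
  Action.Hom.ext (FGModuleCat.hom_ext (LinearMap.ext h))

theorem tensorHom_ext {f g : X ⊗ Y ⟶ Z}
    (h : ∀ x y, lin f (pureTensor x y) = lin g (pureTensor x y)) : f = g :=
  Action.Hom.ext (FGModuleCat.hom_ext (TensorProduct.ext' h))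

theorem tensorHom_ext₃ {W : FDRep ℂ G} {f g : (X ⊗ Y) ⊗ Z ⟶ W}
    (h : ∀ x y z, lin f (pureTensor (pureTensor x y) z) = lin g (pureTensor (pureTensor x y) z)) :
    f = g :=
  Action.Hom.ext (FGModuleCat.hom_ext (TensorProduct.ext_threefold h))

/-- The morphism of representations given by an equivariant linear map. -/
def repHom (f : X.V →ₗ[ℂ] Y.V) (h : ∀ g x, f (X.ρ g x) = Y.ρ g (f x)) : X ⟶ Y where
  hom := ConcreteCategory.ofHom f
  comm g := by
    apply FGModuleCat.hom_ext
    exact LinearMap.ext (h g)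

theorem lin_repHom (f : X.V →ₗ[ℂ] Y.V) (h) (x : X.V) : lin (repHom f h) x = f x := rfl

theorem equivariant_of_pureTensor {f : (X ⊗ Y : FDRep ℂ G).V →ₗ[ℂ] Z.V}
    (h : ∀ g x y, f ((X ⊗ Y).ρ g (pureTensor x y)) = Z.ρ g (f (pureTensor x y))) (g : G)
    (t : (X ⊗ Y : FDRep ℂ G).V) : f ((X ⊗ Y).ρ g t) = Z.ρ g (f t) := by
  have : f ∘ₗ (X ⊗ Y).ρ g = Z.ρ g ∘ₗ f := TensorProduct.ext' (h g)
  exact LinearMap.congr_fun this t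

end Lin

/-! ### The regular representation -/

section Regular

variable (G : Type w) [Group G] [Fintype G]

/-- The functions on `G` with the left translation action. The functions live on a copy of `G` in
the lowest universe, since this is where `FDRep ℂ G` takes its vector spaces from. -/
def regular : FDRep ℂ G :=
  FDRep.of (V := Shrink.{0} G → ℂ)
    { toFun h := LinearMap.funLeft ℂ ℂ fun t => equivShrink.{0} G (h⁻¹ * (equivShrink.{0} G).symm t)
      map_one' := by ext; simp [LinearMap.funLeft]
      map_mul' a b := by ext; simp [LinearMap.funLeft, mul_assoc, Module.End.mul_apply] }

variable {G}

/-- The value at `g` of a function on `G`. -/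
def regularCoord (g : G) : (regular G).V →ₗ[ℂ] ℂ :=
  LinearMap.proj (R := ℂ) (φ := fun _ : Shrink.{0} G => ℂ) (equivShrink.{0} G g)

theorem regular_ext {u v : (regular G).V} (h : ∀ g, regularCoord g u = regularCoord g v) :
    u = v := by
  refine funext fun t => ?_
  obtain ⟨g, rfl⟩ := (equivShrink.{0} G).surjective t
  exact h g

theorem regularCoord_rho (g h : G) (u : (regular G).V) :
    regularCoord g ((regular G).ρ h u) = regularCoord (h⁻¹ * g) u := by
  change u (equivShrink.{0} G (h⁻¹ * (equivShrink.{0} G).symm (equivShrink.{0} G g))) =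
    u (equivShrink.{0} G (h⁻¹ * g))
  rw [Equiv.symm_apply_apply]

variable [DecidableEq G]

/-- The indicator function of `g`. -/
def regularBasis (g : G) : (regular G).V :=
  fun t : Shrink.{0} G => if (equivShrink.{0} G).symm t = g then (1 : ℂ) else 0

theorem regularCoord_basis (g h : G) :
    regularCoord g (regularBasis h) = if g = h then 1 else 0 := by
  change (if (equivShrink.{0} G).symm (equivShrink.{0} G g) = h then (1 : ℂ) else 0) = _
  rw [Equiv.symm_apply_apply]

theorem regular_rho_basis (g h : G) : (regular G).ρ g (regularBasis h) = regularBasis (g * h) := by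
  refine regular_ext fun k => ?_
  rw [regularCoord_rho, regularCoord_basis, regularCoord_basis]
  simp only [inv_mul_eq_iff_eq_mul]

theorem sum_regularCoord_smul (u : (regular G).V) : ∑ g, regularCoord g u • regularBasis g = u := by
  refine regular_ext fun k => ?_
  simp [regularCoord_basis]

/-- The morphism from the regular representation that sends the indicator function of `1` to `u`. -/
def regularHom {U : FDRep ℂ G} (u : U.V) : regular G ⟶ U :=
  repHom (∑ g, (regularCoord g).smulRight (U.ρ g u)) fun h v => by
    simp only [LinearMap.coe_sum, Finset.sum_apply, LinearMap.smulRight_apply, regularCoord_rho,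
      map_sum, map_smul, ← rho_mul_apply]
    exact Fintype.sum_equiv (Equiv.mulLeft h⁻¹) _ _ fun g => by simp

theorem regularHom_basis {U : FDRep ℂ G} (u : U.V) (g : G) :
    lin (regularHom u) (regularBasis g) = U.ρ g u := by
  simp only [regularHom, lin_repHom, LinearMap.coe_sum, Finset.sum_apply,
    LinearMap.smulRight_apply, regularCoord_basis]
  simp

end Regular

/-! ### Half-braidings on representations are gradings by the group -/

section Grading

variable {G : Type w} [Group G] [Fintype G]

/-- The coefficient of the indicator function of `g` in a tensor of `regular G ⊗ V`. -/
def leftCoeff (V : FDRep ℂ G) (g : G) : (regular G ⊗ V : FDRep ℂ G).V →ₗ[ℂ] V.V :=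
  TensorProduct.lift (LinearMap.lsmul ℂ V.V ∘ₗ regularCoord g)

theorem leftCoeff_pureTensor (V : FDRep ℂ G) (g : G) (u : (regular G).V) (v : V.V) :
    leftCoeff V g (pureTensor u v) = regularCoord g u • v := rfl

/-- The map `V ⊗ U ⟶ U ⊗ V` which lets `g` act on `U` next to the part of `V` of degree `g`. -/
def crossLin (V : FDRep ℂ G) (p : G → V.V →ₗ[ℂ] V.V) (U : FDRep ℂ G) :
    (V ⊗ U : FDRep ℂ G).V →ₗ[ℂ] (U ⊗ V : FDRep ℂ G).V :=
  ∑ g, (TensorProduct.comm ℂ V.V U.V).toLinearMap ∘ₗ TensorProduct.map (p g) (U.ρ g)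

/-- The inverse of `crossLin`. -/
def crossInvLin (V : FDRep ℂ G) (p : G → V.V →ₗ[ℂ] V.V) (U : FDRep ℂ G) :
    (U ⊗ V : FDRep ℂ G).V →ₗ[ℂ] (V ⊗ U : FDRep ℂ G).V :=
  ∑ g, (TensorProduct.comm ℂ U.V V.V).toLinearMap ∘ₗ TensorProduct.map (U.ρ g⁻¹) (p g)

theorem crossLin_apply (V : FDRep ℂ G) (p : G → V.V →ₗ[ℂ] V.V) (U : FDRep ℂ G) (x : V.V)
    (u : U.V) : crossLin V p U (pureTensor x u) = ∑ g, pureTensor (U.ρ g u) (p g x) := by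
  simp only [crossLin, LinearMap.coe_sum, Finset.sum_apply]
  rfl

theorem crossInvLin_apply (V : FDRep ℂ G) (p : G → V.V →ₗ[ℂ] V.V) (U : FDRep ℂ G) (x : V.V)
    (u : U.V) : crossInvLin V p U (pureTensor u x) = ∑ g, pureTensor (p g x) (U.ρ g⁻¹ u) := by
  simp only [crossInvLin, LinearMap.coe_sum, Finset.sum_apply]
  rfl

variable [DecidableEq G]

theorem sum_leftCoeff (V : FDRep ℂ G) (t : (regular G ⊗ V : FDRep ℂ G).V) :
    ∑ g, pureTensor (regularBasis g) (leftCoeff V g t) = t := by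
  have : ∑ g, (TensorProduct.mk ℂ (regular G).V V.V (regularBasis g)) ∘ₗ leftCoeff V g =
      LinearMap.id := by
    refine TensorProduct.ext' fun u v => ?_
    simp only [LinearMap.coe_sum, Finset.sum_apply, LinearMap.comp_apply]
    conv_rhs => rw [← sum_regularCoord_smul u]
    rw [TensorProduct.sum_tmul]
    exact Finset.sum_congr rfl fun g _ => (TensorProduct.smul_tmul _ _ _).symm
  simpa using LinearMap.congr_fun this t

/-- The projection of an object of the center of `Rep(G)` to its part of degree `g`, read off from
the half-braiding with the regular representation. -/
def grade (X : Center (FDRep ℂ G)) (g : G) : X.1.V →ₗ[ℂ] X.1.V :=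
  leftCoeff X.1 g ∘ₗ lin (X.2.β (regular G)).hom ∘ₗ
    (TensorProduct.mk ℂ X.1.V (regular G).V).flip (regularBasis 1)

/-- The half-braiding moves a vector of degree `g` past `u` by letting `g` act on `u`. -/
theorem halfBraiding_apply (X : Center (FDRep ℂ G)) (U : FDRep ℂ G) (x : X.1.V) (u : U.V) :
    lin (X.2.β U).hom (pureTensor x u) = ∑ g, pureTensor (U.ρ g u) (grade X g x) := by
  have h := congrArg (fun f => lin f (pureTensor x (regularBasis 1)))
    (X.2.naturality (regularHom u))
  simp only [lin_comp] at h
  rw [lin_whiskerLeft, regularHom_basis, rho_one_apply] at h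
  rw [h, ← sum_leftCoeff X.1 (lin (X.2.β (regular G)).hom (pureTensor x (regularBasis 1))), map_sum]
  refine Finset.sum_congr rfl fun g _ => ?_
  rw [lin_whiskerRight, regularHom_basis]
  rfl

/-- The degrees exhaust the space: this is the half-braiding with the unit object. -/
theorem sum_grade (X : Center (FDRep ℂ G)) (x : X.1.V) : ∑ g, grade X g x = x := by
  have h := congrArg (fun f => lin f (pureTensor x ((1 : ℂ) : (𝟙_ (FDRep ℂ G)).V)))
    (halfBraiding_unit_hom X.2)
  simp only [halfBraiding_apply] at h
  have h2 := congrArg (lin (λ_ X.1).hom) h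
  rw [map_sum] at h2
  have h3 : lin (λ_ X.1).hom (lin ((ρ_ X.1).hom ≫ (λ_ X.1).inv)
      (pureTensor x ((1 : ℂ) : (𝟙_ (FDRep ℂ G)).V))) = x := by
    rw [← lin_comp, Category.assoc, Iso.inv_hom_id, Category.comp_id]
    exact one_smul ℂ x
  rw [h3] at h2
  refine Eq.trans (Finset.sum_congr rfl fun g _ => ?_) h2
  exact (one_smul ℂ _).symm

/-- The degrees are orthogonal: this is the half-braiding with `regular G ⊗ regular G`, compared in
the coefficient of the indicator function of `g` times that of `h`. -/
theorem grade_grade (X : Center (FDRep ℂ G)) (g h : G) (x : X.1.V) :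
    grade X h (grade X g x) = if g = h then grade X g x else 0 := by
  have hm := congrArg (fun f => lin f (pureTensor x (pureTensor (regularBasis (1 : G))
    (regularBasis (1 : G))))) (X.2.monoidal (regular G) (regular G))
  simp only [lin_comp] at hm
  rw [halfBraiding_apply, lin_associator_inv, lin_whiskerRight, halfBraiding_apply] at hm
  rw [pureTensor_sum_left] at hm
  simp only [map_sum, lin_associator_hom, lin_whiskerLeft, halfBraiding_apply, pureTensor_sum_right,
    lin_associator_inv, rho_tensor, regular_rho_basis, mul_one] at hm
  have hm2 := congrArg (leftCoeff (regular G ⊗ X.1) g ∘ₗ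
    lin (α_ (regular G) (regular G) X.1).hom) hm
  simp only [map_sum, LinearMap.comp_apply, lin_associator_hom, leftCoeff_pureTensor,
    regularCoord_basis, ite_smul, one_smul, zero_smul, Finset.sum_ite_irrel, Finset.sum_const_zero,
    Finset.sum_ite_eq, Finset.mem_univ, if_true] at hm2
  have hm3 := congrArg (leftCoeff X.1 h) hm2
  simp only [map_sum, leftCoeff_pureTensor, regularCoord_basis, ite_smul, one_smul, zero_smul,
    Finset.sum_ite_eq, Finset.mem_univ, if_true] at hm3
  rw [← hm3]
  simp only [eq_comm]

/-- The group acts on degrees by conjugation: this is the equivariance of the half-braiding with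
the regular representation. -/
theorem rho_grade (X : Center (FDRep ℂ G)) (g h : G) (x : X.1.V) :
    X.1.ρ h (grade X g x) = grade X (h * g * h⁻¹) (X.1.ρ h x) := by
  have h1 := lin_rho (X.2.β (regular G)).hom h (pureTensor x (regularBasis 1))
  rw [rho_tensor] at h1
  simp only [halfBraiding_apply, map_sum, rho_tensor, regular_rho_basis] at h1
  have h2 := congrArg (leftCoeff X.1 (h * g)) h1
  simp only [map_sum, leftCoeff_pureTensor, regularCoord_basis, ite_smul, one_smul, zero_smul,
    mul_one, mul_right_inj] at h2
  simp only [← mul_inv_eq_iff_eq_mul, Finset.sum_ite_eq, Finset.mem_univ, if_true] at h2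
  exact h2.symm

theorem lin_grade {X Y : Center (FDRep ℂ G)} (f : X ⟶ Y) (g : G) (x : X.1.V) :
    lin f.f (grade X g x) = grade Y g (lin f.f x) := by
  have h := congrArg (fun k => leftCoeff Y.1 g (lin k (pureTensor x (regularBasis 1))))
    (f.comm (regular G))
  simp only [lin_comp] at h
  rw [lin_whiskerRight] at h
  simp only [halfBraiding_apply, map_sum, lin_whiskerLeft, leftCoeff_pureTensor,
    regular_rho_basis, regularCoord_basis, ite_smul, one_smul, zero_smul, mul_one,
    Finset.sum_ite_eq, Finset.mem_univ, if_true] at h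
  exact h.symm

/-- An equivariant map that preserves degrees is a morphism of the center. -/
def centerHom {X Y : Center (FDRep ℂ G)} (f : X.1.V →ₗ[ℂ] Y.1.V)
    (hρ : ∀ g x, f (X.1.ρ g x) = Y.1.ρ g (f x))
    (hg : ∀ g x, f (grade X g x) = grade Y g (f x)) : X ⟶ Y where
  f := repHom f hρ
  comm U := tensorHom_ext fun x u => by
    rw [lin_comp, lin_comp, lin_whiskerRight, halfBraiding_apply, halfBraiding_apply, map_sum]
    exact Finset.sum_congr rfl fun g _ => by rw [lin_whiskerLeft, lin_repHom, lin_repHom, hg]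

/-- A `G`-grading of a representation `V`, given by the projections to the homogeneous parts, that
is compatible with the conjugation action of `G` on the degrees. -/
structure IsGrading (V : FDRep ℂ G) (p : G → V.V →ₗ[ℂ] V.V) : Prop where
  sum : ∀ x, ∑ g, p g x = x
  proj : ∀ g h x, p h (p g x) = if g = h then p g x else 0
  rho : ∀ g h x, V.ρ h (p g x) = p (h * g * h⁻¹) (V.ρ h x)

namespace IsGrading

variable {V : FDRep ℂ G} {p : G → V.V →ₗ[ℂ] V.V}

/-- The half-braiding with `U` given by a grading of `V`. -/
def cross (hp : IsGrading V p) (U : FDRep ℂ G) : V ⊗ U ≅ U ⊗ V where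
  hom := repHom (crossLin V p U) <| equivariant_of_pureTensor fun h x u => by
    rw [rho_tensor, crossLin_apply, crossLin_apply, map_sum]
    refine (Fintype.sum_equiv (MulAut.conj h).toEquiv _ _ fun g => ?_).symm
    rw [rho_tensor, hp.rho, MulEquiv.toEquiv_eq_coe, EquivLike.coe_coe, MulAut.conj_apply,
      ← rho_mul_apply, ← rho_mul_apply, inv_mul_cancel_right]
  inv := repHom (crossInvLin V p U) <| equivariant_of_pureTensor fun h u x => by
    rw [rho_tensor, crossInvLin_apply, crossInvLin_apply, map_sum]
    refine (Fintype.sum_equiv (MulAut.conj h).toEquiv _ _ fun g => ?_).symm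
    rw [rho_tensor, hp.rho, MulEquiv.toEquiv_eq_coe, EquivLike.coe_coe, MulAut.conj_apply,
      ← rho_mul_apply, ← rho_mul_apply]
    simp [mul_assoc]
  hom_inv_id := tensorHom_ext fun x u => by
    rw [lin_comp, lin_repHom, lin_repHom, crossLin_apply, map_sum]
    have h1 (g : G) : crossInvLin V p U (pureTensor (U.ρ g u) (p g x)) = pureTensor (p g x) u := by
      rw [crossInvLin_apply, Finset.sum_eq_single g]
      · rw [hp.proj, if_pos rfl, rho_inv_rho]
      · intro h _ hh
        rw [hp.proj, if_neg hh.symm]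
        exact TensorProduct.zero_tmul _ _
      · simp
    rw [Finset.sum_congr rfl fun g _ => h1 g, ← pureTensor_sum_left, hp.sum]
    rfl
  inv_hom_id := tensorHom_ext fun u x => by
    rw [lin_comp, lin_repHom, lin_repHom, crossInvLin_apply, map_sum]
    have h1 (g : G) : crossLin V p U (pureTensor (p g x) (U.ρ g⁻¹ u)) = pureTensor u (p g x) := by
      rw [crossLin_apply, Finset.sum_eq_single g]
      · rw [hp.proj, if_pos rfl, rho_rho_inv]
      · intro h _ hh
        rw [hp.proj, if_neg hh.symm]
        exact TensorProduct.tmul_zero _ _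
      · simp
    rw [Finset.sum_congr rfl fun g _ => h1 g, ← pureTensor_sum_right, hp.sum]
    rfl

theorem cross_hom_apply (hp : IsGrading V p) (U : FDRep ℂ G) (x : V.V) (u : U.V) :
    lin (hp.cross U).hom (pureTensor x u) = ∑ g, pureTensor (U.ρ g u) (p g x) :=
  crossLin_apply V p U x u

/-- The half-braiding of a grading is monoidal, since a homogeneous part has just one degree. -/
theorem cross_tensor (hp : IsGrading V p) (U U' : FDRep ℂ G) :
    (hp.cross (U ⊗ U')).hom = (α_ _ _ _).inv ≫ (hp.cross U).hom ▷ U' ≫ (α_ _ _ _).hom ≫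
      U ◁ (hp.cross U').hom ≫ (α_ _ _ _).inv := by
  rw [← cancel_epi (α_ V U U').hom]
  refine tensorHom_ext₃ fun x u u' => ?_
  simp only [Iso.hom_inv_id_assoc]
  rw [lin_comp, lin_comp, lin_comp, lin_comp, lin_associator_hom, lin_whiskerRight,
    cross_hom_apply, cross_hom_apply, pureTensor_sum_left, map_sum, map_sum, map_sum]
  refine Finset.sum_congr rfl fun g _ => ?_
  rw [lin_associator_hom, lin_whiskerLeft, cross_hom_apply, pureTensor_sum_right, map_sum,
    Finset.sum_eq_single g]
  · rw [hp.proj, if_pos rfl, lin_associator_inv, rho_tensor]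
  · intro h _ hh
    rw [hp.proj, if_neg hh.symm, lin_associator_inv]
    exact TensorProduct.tmul_zero _ _
  · simp

/-- A graded representation as an object of the center. -/
def toCenter (hp : IsGrading V p) : Center (FDRep ℂ G) :=
  ⟨V, { β := hp.cross
        monoidal := hp.cross_tensor
        naturality := fun {U U'} f => tensorHom_ext fun x u => by
          rw [lin_comp, lin_comp, lin_whiskerLeft, cross_hom_apply, cross_hom_apply, map_sum]
          exact Finset.sum_congr rfl fun g _ => by rw [lin_whiskerRight, lin_rho] }⟩

theorem grade_toCenter (hp : IsGrading V p) (g : G) (x : V.V) : grade hp.toCenter g x = p g x := by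
  change leftCoeff V g (crossLin V p (regular G) (pureTensor x (regularBasis 1))) = _
  rw [crossLin_apply, map_sum]
  simp only [leftCoeff_pureTensor, regular_rho_basis, regularCoord_basis, ite_smul, one_smul,
    zero_smul, mul_one, Finset.sum_ite_eq, Finset.mem_univ, if_true]

end IsGrading

end Grading

/-! ### The twist and the dimension in the center of the representation category -/

section Twist

variable {G : Type w} [Group G] [Fintype G] [DecidableEq G]

/-- The endomorphism of an object of the center by which `g ^ k` acts on the vectors of degree `g`,
for all `g`. -/
def degreeAct (X : Center (FDRep ℂ G)) (k : ℤ) : X.1.V →ₗ[ℂ] X.1.V :=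
  ∑ g, X.1.ρ (g ^ k) ∘ₗ grade X g

theorem degreeAct_apply (X : Center (FDRep ℂ G)) (k : ℤ) (x : X.1.V) :
    degreeAct X k x = ∑ g, X.1.ρ (g ^ k) (grade X g x) := by
  simp [degreeAct]

theorem degreeAct_zero (X : Center (FDRep ℂ G)) (x : X.1.V) : degreeAct X 0 x = x := by
  simp only [degreeAct_apply, zpow_zero, rho_one_apply, sum_grade]

theorem rho_zpow_grade (X : Center (FDRep ℂ G)) (g : G) (l : ℤ) (x : X.1.V) :
    X.1.ρ (g ^ l) (grade X g x) = grade X g (X.1.ρ (g ^ l) x) := by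
  rw [rho_grade, (Commute.refl g).zpow_left l |>.eq, mul_inv_cancel_right]

theorem degreeAct_degreeAct (X : Center (FDRep ℂ G)) (k l : ℤ) (x : X.1.V) :
    degreeAct X k (degreeAct X l x) = degreeAct X (k + l) x := by
  simp only [degreeAct_apply, map_sum]
  refine Finset.sum_congr rfl fun g _ => ?_
  rw [Finset.sum_eq_single g]
  · rw [rho_zpow_grade X g l, grade_grade, if_pos rfl, ← rho_zpow_grade, zpow_add, rho_mul_apply]
  · intro h _ hh
    rw [rho_zpow_grade X g l, grade_grade, if_neg hh.symm, map_zero]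
  · simp

/-- `degreeAct X k` as a morphism of representations. -/
def degreeHom (X : Center (FDRep ℂ G)) (k : ℤ) : X.1 ⟶ X.1 :=
  repHom (degreeAct X k) fun h x => by
    simp only [degreeAct_apply, map_sum]
    refine (Fintype.sum_equiv (MulAut.conj h).toEquiv _ _ fun g => ?_).symm
    rw [MulEquiv.toEquiv_eq_coe, EquivLike.coe_coe, ← map_zpow, MulAut.conj_apply,
      MulAut.conj_apply, ← rho_grade, ← rho_mul_apply, ← rho_mul_apply, inv_mul_cancel_right]

/-- The Drinfeld isomorphism of the center is the one of `Rep(G)` up to the action of `g⁻¹` in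
degree `g`: the half-braiding lets `g` act on the dual, and the evaluation turns this into the
action of `g⁻¹` on the space. -/
theorem center_drinfeldIso_hom_f (X : Center (FDRep ℂ G)) :
    (drinfeldIso X).hom.f = degreeHom X (-1) ≫ (pivot X.1).hom := by
  apply rightDual_hom_ext (X := (X.1ᵛ : FDRep ℂ G)) (Y := X.1ᵛᵛ)
  have h := congrArg Center.Hom.f (drinfeldIso_evaluation X)
  rw [comp_whiskerRight_assoc]
  refine h.trans ?_
  change (X.2.β X.1ᵛ).hom ≫ ε_ X.1 X.1ᵛ = degreeHom X (-1) ▷ X.1ᵛ ≫ (drinfeldIso X.1).hom ▷ X.1ᵛ ≫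
    ε_ (X.1ᵛ) _
  rw [drinfeldIso_evaluation]
  refine tensorHom_ext fun x φ => ?_
  rw [lin_comp, lin_comp, lin_comp, lin_whiskerRight, lin_braiding, halfBraiding_apply, degreeHom,
    lin_repHom, degreeAct_apply, pureTensor_sum_right, map_sum, map_sum]
  refine Finset.sum_congr rfl fun g _ => ?_
  have h2 := lin_rho (ε_ X.1 X.1ᵛ) g (pureTensor φ (X.1.ρ (g ^ (-1 : ℤ)) (grade X g x)))
  rw [rho_tensor, zpow_neg_one, rho_rho_inv] at h2
  rw [zpow_neg_one]
  exact h2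

/-- The twist of the center acts by `g` on the vectors of degree `g`. -/
theorem lin_twist (X : Center (FDRep ℂ G)) (x : X.1.V) :
    lin (twist X).hom.f x = degreeAct X 1 x := by
  have h : (twist X).hom.f ≫ degreeHom X (-1) = 𝟙 X.1 := by
    have ht : (twist X).hom ≫ (drinfeldIso X).hom = (pivot X).hom := by
      simp [twist]
    rw [← cancel_mono (pivot X.1).hom, Category.assoc, ← center_drinfeldIso_hom_f]
    refine (congrArg Center.Hom.f ht).trans ?_
    rw [Category.id_comp]
    rfl
  have h2 := congrArg (fun f => degreeAct X 1 (lin f x)) h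
  simp only [lin_comp, degreeHom, lin_repHom, degreeAct_degreeAct, add_neg_cancel,
    degreeAct_zero] at h2
  exact h2

/-- If the twist is a scalar then so are its powers, for negative exponents too since the scalar is
invertible. -/
theorem degreeAct_eq_zpow_smul (X : Center (FDRep ℂ G)) {c : ℂ} (hc : (twist X).hom = c • 𝟙 X)
    (hX : Nontrivial X.1.V) (k : ℤ) (x : X.1.V) : degreeAct X k x = c ^ k • x := by
  have h1 (x : X.1.V) : degreeAct X 1 x = c • x := by
    rw [← lin_twist, hc]; rfl
  obtain ⟨y, hy⟩ := exists_ne (0 : X.1.V)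
  have hc0 : c ≠ 0 := by
    rintro rfl
    have := degreeAct_degreeAct X (-1) 1 y
    rw [h1, zero_smul, map_zero, neg_add_cancel, degreeAct_zero] at this
    exact hy this.symm
  induction k with
  | zero => rw [degreeAct_zero, zpow_zero, one_smul]
  | succ k ih =>
    rw [← degreeAct_degreeAct, h1, map_smul, ih, smul_smul, zpow_add_one₀ hc0, mul_comm]
  | pred k ih =>
    have := degreeAct_degreeAct X (-(k : ℤ) - 1) 1 x
    rw [h1, map_smul, sub_add_cancel, ih] at this
    rw [zpow_sub_one₀ hc0, mul_comm, mul_smul, ← this, inv_smul_smul₀ hc0]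

end Twist

section Dimension

variable {G : Type w} [Group G]

theorem scalar_eq {C : Type u} [Category.{v} C] [Preadditive C] [Linear ℂ C] {X : C}
    (hX : 𝟙 X ≠ 0) {f : X ⟶ X} {c : ℂ} (h : f = c • 𝟙 X) : scalar f = c := by
  have hex : ∃ c : ℂ, f = c • 𝟙 X := ⟨c, h⟩
  rw [scalar, dif_pos hex]
  exact smul_left_injective ℂ hX (hex.choose_spec.symm.trans h)

variable (G) in
/-- The vector space underlying the unit object of `Rep(G)` is `ℂ`. -/
def unitEquiv : (𝟙_ (FDRep ℂ G)).V ≃ₗ[ℂ] ℂ := LinearEquiv.refl ℂ ℂ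

theorem leftTrace_rep (V : FDRep ℂ G) :
    leftTrace (𝟙 V) = η_ V Vᵛ ≫ (β_ V Vᵛ).hom ≫ ε_ V Vᵛ := by
  have h := drinfeldIso_coevaluation V
  rw [← SymmetricCategory.braiding_swap_eq_inv_braiding] at h
  rw [leftTrace, MonoidalCategory.whiskerLeft_id, Category.id_comp, ← Category.assoc,
    ← Category.assoc]
  exact congrArg (· ≫ ε_ V Vᵛ) h

/-- The pivotal dimension in `Rep(G)` is the dimension of the vector space: the evaluation of the
coevaluation pairs a basis with its dual basis. -/
theorem lin_leftTrace_id (V : FDRep ℂ G) (c : (𝟙_ (FDRep ℂ G)).V) :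
    lin (leftTrace (𝟙 V)) c = (Module.finrank ℂ V.V : ℂ) • c := by
  let b := Module.finBasis ℂ V.V
  let o := (unitEquiv G).symm 1
  obtain ⟨y, hy⟩ : ∃ y : Fin (Module.finrank ℂ V.V) → (Vᵛ : FDRep ℂ G).V,
      lin (η_ V Vᵛ) o = ∑ i, pureTensor (b i) (y i) := by
    obtain ⟨f, hf⟩ := TensorProduct.eq_repr_basis_left b (lin (η_ V Vᵛ) o)
    exact ⟨f, hf.symm.trans (Finsupp.sum_fintype _ _ fun _ => TensorProduct.tmul_zero _ _)⟩
  -- By the zigzag identity, `y` is the dual basis of `b`.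
  have hz (x : V.V) : ∑ i, unitEquiv G (lin (ε_ V Vᵛ) (pureTensor (y i) x)) • b i = x := by
    have h := congrArg (fun f => lin (f ≫ (ρ_ V).hom) (pureTensor o x))
      (ExactPairing.evaluation_coevaluation V Vᵛ)
    simp only [lin_comp] at h
    rw [lin_whiskerRight, hy, pureTensor_sum_left] at h
    simp only [map_sum, lin_associator_hom, lin_whiskerLeft] at h
    refine h.trans ?_
    rw [← lin_comp, Iso.inv_hom_id]
    exact one_smul ℂ x
  have hb (i : Fin (Module.finrank ℂ V.V)) :
      unitEquiv G (lin (ε_ V Vᵛ) (pureTensor (y i) (b i))) = 1 := by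
    have h := congrArg (fun v => b.repr v i) (hz (b i))
    simpa [Finsupp.single_apply] using h
  have h1 : unitEquiv G (lin (leftTrace (𝟙 V)) o) = Module.finrank ℂ V.V := by
    rw [leftTrace_rep, lin_comp, lin_comp, hy, map_sum, map_sum, map_sum]
    refine (Finset.sum_congr rfl fun i _ => hb i).trans ?_
    simp
  have h2 : c = unitEquiv G c • o := (mul_one (M := ℂ) (unitEquiv G c)).symm
  apply (unitEquiv G).injective
  rw [h2, map_smul, map_smul, h1, map_smul, map_smul, LinearEquiv.apply_symm_apply]
  simp [mul_comm]

theorem pivotalDim_center (X : Center (FDRep ℂ G)) :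
    pivotalDim X = Module.finrank ℂ X.1.V := by
  refine scalar_eq ?_ ?_
  · intro h
    have := congrArg (fun f : 𝟙_ (Center (FDRep ℂ G)) ⟶ 𝟙_ _ => lin f.f (1 : ℂ)) h
    exact one_ne_zero (α := ℂ) this
  · refine Center.ext _ _ ?_
    rw [center_leftTrace_f]
    exact repHom_ext fun c => lin_leftTrace_id X.1 c

end Dimension

/-! ### The Drinfeld double -/

/-- The Drinfeld double of the group algebra of `G`. The value of `f` at `g` and `h` is the
coefficient in `f` of the basis vector `δ_g h`, where the `δ_g` are orthogonal idempotents with sum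
`1` and `h δ_g = δ_(h g h⁻¹) h`. -/
def Double (G : Type*) : Type _ := G → G → ℂ

namespace Double

variable {G : Type*}

instance : AddCommGroup (Double G) := inferInstanceAs (AddCommGroup (G → G → ℂ))

instance : Module ℂ (Double G) := inferInstanceAs (Module ℂ (G → G → ℂ))

instance [Finite G] : Module.Finite ℂ (Double G) :=
  inferInstanceAs (Module.Finite ℂ (G → G → ℂ))

@[ext]
theorem ext {a b : Double G} (h : ∀ g k, a g k = b g k) : a = b := funext fun g => funext (h g)

@[simp] theorem add_apply (a b : Double G) (g k : G) : (a + b) g k = a g k + b g k := rfl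

@[simp] theorem smul_apply (c : ℂ) (a : Double G) (g k : G) : (c • a) g k = c * a g k := rfl

@[simp] theorem zero_apply (g k : G) : (0 : Double G) g k = 0 := rfl

theorem sum_apply {ι : Type*} (s : Finset ι) (F : ι → Double G) (g k : G) :
    (∑ i ∈ s, F i) g k = ∑ i ∈ s, F i g k :=
  map_sum (⟨⟨fun a : Double G => a g k, rfl⟩, fun _ _ => rfl⟩ : Double G →+ ℂ) F s

section Mul

variable [Group G] [Fintype G]

instance : Mul (Double G) := ⟨fun a b g k => ∑ h, a g h * b (h⁻¹ * g * h) (h⁻¹ * k)⟩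

theorem mul_apply (a b : Double G) (g k : G) :
    (a * b) g k = ∑ h, a g h * b (h⁻¹ * g * h) (h⁻¹ * k) := rfl

end Mul

section One

variable [DecidableEq G]

/-- The group element `h` in the Drinfeld double of `G`. -/
def of (h : G) : Double G := fun _ k => if k = h then 1 else 0

theorem of_apply (h g k : G) : of h g k = if k = h then 1 else 0 := rfl

variable [Group G]

instance : One (Double G) := ⟨of 1⟩

theorem of_one : of (1 : G) = 1 := rfl

theorem one_apply (g k : G) : (1 : Double G) g k = if k = 1 then 1 else 0 := rfl

/-- The idempotent `δ_g` of the Drinfeld double of `G`. -/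
def delta (g : G) : Double G := fun g' k => if g' = g ∧ k = 1 then 1 else 0

theorem delta_apply (g g' k : G) : delta g g' k = if g' = g ∧ k = 1 then 1 else 0 := rfl

end One

variable [Group G] [Fintype G] [DecidableEq G]

instance : Ring (Double G) where
  __ := (inferInstance : AddCommGroup (Double G))
  left_distrib a b c := by
    ext g k
    simp only [mul_apply, add_apply, mul_add, Finset.sum_add_distrib]
  right_distrib a b c := by
    ext g k
    simp only [mul_apply, add_apply, add_mul, Finset.sum_add_distrib]
  zero_mul a := by
    ext g k
    simp [mul_apply]
  mul_zero a := by
    ext g k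
    simp [mul_apply]
  mul_assoc a b c := by
    ext g k
    simp only [mul_apply, Finset.sum_mul, Finset.mul_sum]
    rw [Finset.sum_comm]
    refine Finset.sum_congr rfl fun h _ => ?_
    refine (Fintype.sum_equiv (Equiv.mulLeft h) _ _ fun l => ?_).symm
    simp [mul_assoc]
  one_mul a := by
    ext g k
    simp [mul_apply, one_apply]
  mul_one a := by
    ext g k
    simp [mul_apply, one_apply, inv_mul_eq_one]

instance : Algebra ℂ (Double G) :=
  Algebra.ofModule
    (fun c a b => by ext g k; simp only [mul_apply, smul_apply, Finset.mul_sum, mul_assoc])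
    (fun c a b => by
      ext g k; simp only [mul_apply, smul_apply, Finset.mul_sum, mul_left_comm])

theorem delta_mul_apply (g : G) (a : Double G) (g' k : G) :
    (delta g * a) g' k = if g' = g then a g k else 0 := by
  rw [mul_apply, Finset.sum_eq_single 1]
  · by_cases h : g' = g <;> simp [delta_apply, h]
  · intro h _ hh
    simp [delta_apply, hh]
  · simp

theorem of_mul_apply (h : G) (a : Double G) (g k : G) :
    (of h * a) g k = a (h⁻¹ * g * h) (h⁻¹ * k) := by
  simp [mul_apply, of_apply]

theorem of_mul_of (h k : G) : of h * of k = of (h * k) := by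
  ext g l
  simp [of_mul_apply, of_apply, inv_mul_eq_iff_eq_mul]

theorem delta_mul_delta (g h : G) : delta h * delta g = if g = h then delta g else 0 := by
  ext g' k
  rw [delta_mul_apply]
  split_ifs with h1 h2 h2
  · simp [delta_apply, h1, h2]
  · simp [delta_apply, Ne.symm h2]
  · simp [delta_apply, h2, h1]
  · rfl

theorem sum_delta : ∑ g : G, delta g = 1 := by
  ext g k
  simp [sum_apply, delta_apply, one_apply, ite_and]

theorem of_mul_delta (h g : G) : of h * delta g = delta (h * g * h⁻¹) * of h := by
  ext g' k
  rw [delta_mul_apply, of_mul_apply, delta_apply, of_apply, ite_and]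
  simp only [inv_mul_eq_one, eq_comm (a := h)]
  refine if_congr ?_ rfl rfl
  rw [eq_mul_inv_iff_mul_eq, mul_assoc, inv_mul_eq_iff_eq_mul]

/-- The elements `δ_g h` span the Drinfeld double. -/
theorem eq_sum (a : Double G) : a = ∑ g, ∑ k, a g k • (delta g * of k) := by
  ext g k
  simp [sum_apply, delta_mul_apply, of_apply]

/-- The algebra map from the Drinfeld double given by a graded representation. -/
def lift {V : Type*} [AddCommGroup V] [Module ℂ V] (r p : G → Module.End ℂ V) (hr : r 1 = 1)
    (hr' : ∀ g h, r g * r h = r (g * h)) (hp : ∑ g, p g = 1)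
    (hp' : ∀ g h, p h * p g = if g = h then p g else 0)
    (hrp : ∀ g h, r h * p g = p (h * g * h⁻¹) * r h) : Double G →ₐ[ℂ] Module.End ℂ V :=
  AlgHom.ofLinearMap
    { toFun a := ∑ g, ∑ k, a g k • (p g * r k)
      map_add' a b := by simp [add_smul, Finset.sum_add_distrib]
      map_smul' c a := by simp [Finset.smul_sum, mul_smul] }
    (by simp [one_apply, hr, hp])
    (fun a b => by
      simp only [LinearMap.coe_mk, AddHom.coe_mk, Finset.sum_mul, mul_apply]
      refine Finset.sum_congr rfl fun g _ => ?_
      simp only [Finset.sum_smul]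
      rw [Finset.sum_comm]
      refine Finset.sum_congr rfl fun k _ => ?_
      have h1 (g' l : G) : a g k • (p g * r k) * b g' l • (p g' * r l) =
          if k * g' * k⁻¹ = g then (a g k * b g' l) • (p g * r (k * l)) else 0 := by
        rw [smul_mul_smul_comm, ← hr', mul_assoc, ← mul_assoc (r k), hrp, mul_assoc (p _),
          ← mul_assoc (p g), hp']
        split_ifs with h
        · rw [h]
        · rw [zero_mul, smul_zero]
      simp only [Finset.mul_sum, h1]
      symm
      rw [Finset.sum_eq_single (k⁻¹ * g * k)]
      · refine Fintype.sum_equiv (Equiv.mulLeft k) _ _ fun l => ?_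
        simp [mul_assoc]
      · intro g' _ hg'
        refine Finset.sum_eq_zero fun l _ => if_neg fun h => hg' ?_
        rw [← h]; group
      · simp)

section Smul

variable {M : Type*} [AddCommGroup M] [Module (Double G) M]

theorem of_smul_of_smul (h k : G) (x : M) : of h • of k • x = of (h * k) • x := by
  rw [← mul_smul, of_mul_of]

theorem delta_smul_delta_smul (g h : G) (x : M) :
    delta h • delta g • x = if g = h then delta g • x else 0 := by
  rw [← mul_smul, delta_mul_delta, ite_smul, zero_smul]

theorem of_smul_delta_smul (h g : G) (x : M) :
    of h • delta g • x = delta (h * g * h⁻¹) • of h • x := by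
  rw [← mul_smul, of_mul_delta, mul_smul]

end Smul

section Module

variable {M N : Type*} [AddCommGroup M] [Module ℂ M] [Module (Double G) M]
  [IsScalarTower ℂ (Double G) M] [AddCommGroup N] [Module ℂ N] [Module (Double G) N]
  [IsScalarTower ℂ (Double G) N]

/-- A linear map between modules over the Drinfeld double is a module map if it respects degrees
and the action of `G`. -/
def linearMapOf (f : M →ₗ[ℂ] N) (hd : ∀ g x, f (delta (G := G) g • x) = delta g • f x)
    (ho : ∀ k x, f (of (G := G) k • x) = of k • f x) : M →ₗ[Double G] N where
  __ := f
  map_smul' a x := by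
    conv_lhs => rw [eq_sum a]
    conv_rhs => rw [eq_sum a]
    simp [Finset.sum_smul, mul_smul, hd, ho]

variable (G) in
/-- The average of a linear map over the Drinfeld double. -/
def averageLin (f : M →ₗ[ℂ] N) : M →ₗ[ℂ] N :=
  (Fintype.card G : ℂ)⁻¹ • ∑ h : G, ∑ g : G,
    Algebra.lsmul ℂ ℂ N (of h⁻¹ * delta g) ∘ₗ f ∘ₗ Algebra.lsmul ℂ ℂ M (delta g * of h)

theorem averageLin_apply (f : M →ₗ[ℂ] N) (x : M) : averageLin G f x =
    (Fintype.card G : ℂ)⁻¹ • ∑ h : G, ∑ g : G, of h⁻¹ • delta g • f (delta g • of h • x) := by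
  simp [averageLin]

variable (G) in
/-- The average of a linear map over the Drinfeld double, as a module map. -/
def average (f : M →ₗ[ℂ] N) : M →ₗ[Double G] N :=
  linearMapOf (averageLin G f)
    (fun k x => by
      rw [averageLin_apply, averageLin_apply, smul_comm (delta k)]
      congr 1
      simp only [Finset.smul_sum]
      refine Finset.sum_congr rfl fun h _ => Finset.sum_congr rfl fun g _ => ?_
      have h1 (y : N) : delta k • of h⁻¹ • y = of h⁻¹ • delta (h * k * h⁻¹) • y := by
        rw [of_smul_delta_smul]
        congr 2
        group
      rw [h1, of_smul_delta_smul h k, delta_smul_delta_smul, delta_smul_delta_smul]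
      simp only [eq_comm (a := g)]
      split_ifs with h2
      · rw [h2]
      · simp)
    (fun k x => by
      rw [averageLin_apply, averageLin_apply, smul_comm (of k)]
      congr 1
      simp only [Finset.smul_sum]
      refine Fintype.sum_equiv (Equiv.mulRight k) _ _ fun h => ?_
      refine Finset.sum_congr rfl fun g _ => ?_
      rw [of_smul_of_smul, of_smul_of_smul]
      simp)

theorem average_apply (f : M →ₗ[ℂ] N) (x : M) : average G f x =
    (Fintype.card G : ℂ)⁻¹ • ∑ h : G, ∑ g : G, of h⁻¹ • delta g • f (delta g • of h • x) :=
  averageLin_apply f x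

/-- The average of a linear projection onto a submodule is a projection. -/
theorem average_of_forall_mem (p : Submodule (Double G) M) (f : M →ₗ[ℂ] p)
    (hf : ∀ x : p, f x = x) (x : p) : average G f x = x := by
  have h1 (h g : G) : of h⁻¹ • delta g • f (delta g • of h • (x : M)) =
      of h⁻¹ • delta g • of h • x := by
    have h2 := hf (delta g • of h • x)
    rw [Submodule.coe_smul, Submodule.coe_smul] at h2
    rw [h2, delta_smul_delta_smul, if_pos rfl]
  rw [average_apply]
  simp only [h1, ← Finset.smul_sum, ← Finset.sum_smul, sum_delta, one_smul, of_smul_of_smul,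
    inv_mul_cancel, of_one]
  rw [Finset.sum_const, Finset.card_univ, ← Nat.cast_smul_eq_nsmul ℂ, inv_smul_smul₀]
  exact_mod_cast Fintype.card_ne_zero

end Module

/-- Maschke's theorem for the Drinfeld double. -/
instance : IsSemisimpleRing (Double G) :=
  { exists_isCompl p := by
      obtain ⟨f, hf⟩ := (p.restrictScalars ℂ).subtype.exists_leftInverse_of_injective
        (LinearMap.ker_eq_bot.2 Subtype.val_injective)
      exact ⟨_, LinearMap.isCompl_of_proj
        (average_of_forall_mem p f fun x => LinearMap.congr_fun hf x)⟩ }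

/-! ### The twist element -/

variable (G) in
/-- The central element of the Drinfeld double that acts as `g ^ k` on vectors of degree `g`. -/
def twistElt (k : ℤ) : Double G := ∑ g, delta g * of (g ^ k)

theorem twistElt_mul_apply (k : ℤ) (a : Double G) (g h : G) :
    (twistElt G k * a) g h = a ((g ^ k)⁻¹ * g * g ^ k) ((g ^ k)⁻¹ * h) := by
  simp only [twistElt, Finset.sum_mul, sum_apply, mul_assoc, of_mul_apply, delta_mul_apply]
  simp

/-- Left multiplication by the twist element permutes the basis vectors `δ_g h`; those with
`g ^ k = 1` are the fixed ones. -/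
theorem trace_twistElt (k : ℤ) : LinearMap.trace ℂ (Double G) (LinearMap.mulLeft ℂ (twistElt G k)) =
    (Fintype.card G * Fintype.card {x : G // x ^ k = 1} : ℕ) := by
  let b : Module.Basis (G × G) ℂ (Double G) :=
    (Pi.basisFun ℂ (G × G)).map (LinearEquiv.curry ℂ ℂ G G)
  rw [LinearMap.trace_eq_matrix_trace ℂ b, Matrix.trace]
  have h1 (i : G × G) : Matrix.diag (LinearMap.toMatrix b b (LinearMap.mulLeft ℂ (twistElt G k))) i
      = if i.1 ^ k = 1 then 1 else 0 := by
    rw [Matrix.diag_apply, LinearMap.toMatrix_apply]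
    change (twistElt G k * b i) i.1 i.2 = _
    have h2 (g h : G) : b i g h = if g = i.1 ∧ h = i.2 then 1 else 0 := by
      change (Pi.basisFun ℂ (G × G) i) (g, h) = _
      rw [Pi.basisFun_apply, Pi.single_apply]
      simp [Prod.ext_iff]
    rw [twistElt_mul_apply, h2]
    refine if_congr ?_ rfl rfl
    rw [mul_eq_right, inv_eq_one, and_iff_right_iff_imp]
    intro h
    rw [h, inv_one, one_mul, mul_one]
  rw [Fintype.sum_congr _ _ h1, Fintype.sum_prod_type, Finset.sum_comm]
  simp [Fintype.card_subtype]

end Double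

/-! ### Traces on isotypic components -/

section Isotypic

variable {A : Type*} [Ring A] [Algebra ℂ A]

theorem finrank_end_simple (S : Type*) [AddCommGroup S] [Module ℂ S] [Module A S]
    [IsScalarTower ℂ A S] [IsSimpleModule A S] [Module.Finite ℂ S] :
    Module.finrank ℂ (Module.End A S) = 1 := by
  rw [← (LinearEquiv.ofBijective (Algebra.linearMap ℂ (Module.End A S))
    (IsSimpleModule.algebraMap_end_bijective_of_isAlgClosed ℂ)).finrank_eq, Module.finrank_self]

variable [IsSemisimpleRing A]

section Component

variable (S : Type*) [AddCommGroup S] [Module ℂ S] [Module A S] [IsScalarTower ℂ A S]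
  [IsSimpleModule A S]

/-- A map from `A` to a simple module `S` is the same as a map from the `S`-isotypic component. -/
def restrictComponent : (A →ₗ[A] S) ≃ₗ[ℂ] (isotypicComponent A A S →ₗ[A] S) :=
  LinearEquiv.ofBijective
    { toFun f := f ∘ₗ (isotypicComponent A A S).subtype
      map_add' _ _ := rfl
      map_smul' _ _ := rfl } <| by
    constructor
    · refine (injective_iff_map_eq_zero _).2 fun f hf => ?_
      by_contra h0
      -- A nonzero map is nonzero on a simple submodule, which is then isomorphic to `S`.
      obtain ⟨T, hT, hne⟩ := LinearMap.exists_ne_zero_of_sSup_eq_top h0 _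
        (IsSemisimpleModule.sSup_simples_eq_top A A)
      have : IsSimpleModule A T := hT
      have e : T ≃ₗ[A] S := .ofBijective _ (LinearMap.bijective_of_ne_zero hne)
      have hle : T ≤ isotypicComponent A A S := le_sSup ⟨e⟩
      exact hne (LinearMap.ext fun x => LinearMap.congr_fun hf ⟨x, hle x.2⟩)
    · intro f
      obtain ⟨h, hh⟩ := IsSemisimpleModule.extension_property
        (isotypicComponent A A S).subtype (Submodule.subtype_injective _) f
      exact ⟨h, hh⟩

variable {S} in
theorem mul_eq_smul_of_mem_isotypicComponent {z : A} {c : ℂ} (h : ∀ x : S, z • x = c • x) {a : A}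
    (ha : a ∈ isotypicComponent A A S) : z * a = c • a := by
  obtain ⟨m, ⟨e⟩⟩ := (IsIsotypicOfType.isotypicComponent A A S).linearEquiv_fun
  have h1 : z • (⟨a, ha⟩ : isotypicComponent A A S) = c • ⟨a, ha⟩ := by
    apply e.injective
    refine (e.map_smul z _).trans (Eq.trans ?_ ((e.restrictScalars ℂ).map_smul c _).symm)
    exact funext fun i => h _
  exact congrArg Subtype.val h1

variable [Module.Finite ℂ S]

/-- The multiplicity of a simple module in `A` is its dimension. -/
theorem finrank_isotypicComponent :
    Module.finrank ℂ (isotypicComponent A A S) = Module.finrank ℂ S ^ 2 := by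
  obtain ⟨m, ⟨e⟩⟩ := (IsIsotypicOfType.isotypicComponent A A S).linearEquiv_fun
  have h1 : Module.finrank ℂ (isotypicComponent A A S) = m * Module.finrank ℂ S := by
    rw [(e.restrictScalars ℂ).finrank_eq, Module.finrank_pi_fintype]
    simp
  have h2 : Module.finrank ℂ S = m := by
    rw [← (LinearMap.ringLmapEquivSelf A ℂ S).finrank_eq, (restrictComponent S).finrank_eq,
      (e.congrLeft S ℂ).finrank_eq, ← (LinearMap.lsum A (fun _ : Fin m => S) ℂ).finrank_eq,
      Module.finrank_pi_fintype]
    simp only [finrank_end_simple]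
    simp
  rw [h1, ← h2, sq]

end Component

/-- If `z` acts on the isotypic components of `A` by scalars, then the trace of the multiplication
by `z` is the sum over the components of the scalar times the dimension. -/
theorem trace_mulLeft [Module.Finite ℂ A] (z : A) (s : isotypicComponents A A → ℂ)
    (hs : ∀ c, ∀ x ∈ c.1, z * x = s c • x) :
    LinearMap.trace ℂ A (LinearMap.mulLeft ℂ z) =
      ∑ᶠ c, s c * Module.finrank ℂ c.1 := by
  classical
  have : Fintype (isotypicComponents A A) := Fintype.ofFinite _
  have hint : DirectSum.IsInternal fun c : isotypicComponents A A => c.1.restrictScalars ℂ :=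
    DirectSum.isInternal_submodule_of_iSupIndep_of_iSup_eq_top
      (A := fun c : isotypicComponents A A => c.1)
      ((sSupIndep_iff _).1 (sSupIndep_isotypicComponents A A))
      ((sSup_eq_iSup' _).symm.trans (sSup_isotypicComponents A A))
  have hm (c : isotypicComponents A A) : Set.MapsTo (LinearMap.mulLeft ℂ z)
      (c.1.restrictScalars ℂ) (c.1.restrictScalars ℂ) := fun x hx => c.1.smul_mem z hx
  rw [LinearMap.trace_eq_sum_trace_restrict hint hm, finsum_eq_sum_of_fintype]
  refine Finset.sum_congr rfl fun c _ => ?_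
  have h1 : (LinearMap.mulLeft ℂ z).restrict (hm c) = s c • LinearMap.id :=
    LinearMap.ext fun x => Subtype.ext (hs c x x.2)
  rw [h1, map_smul, LinearMap.trace_id]
  rfl

end Isotypic

/-! ### The center of the representation category and modules over the Drinfeld double -/

section Carrier

variable {G : Type w} [Group G]

/-- The vector space underlying an object of the center of `Rep(G)`, as a module over the Drinfeld
double. -/
def Carrier (X : Center (FDRep ℂ G)) : Type := X.1.V

instance (X : Center (FDRep ℂ G)) : AddCommGroup (Carrier X) := inferInstanceAs (AddCommGroup X.1.V)

instance (X : Center (FDRep ℂ G)) : Module ℂ (Carrier X) := inferInstanceAs (Module ℂ X.1.V)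

instance (X : Center (FDRep ℂ G)) : Module.Finite ℂ (Carrier X) :=
  inferInstanceAs (Module.Finite ℂ X.1.V)

variable [Fintype G] [DecidableEq G]

/-- The action of the Drinfeld double on an object of the center of `Rep(G)`. -/
def doubleAct (X : Center (FDRep ℂ G)) : Double G →ₐ[ℂ] Module.End ℂ (Carrier X) :=
  Double.lift (V := X.1.V) (fun g => X.1.ρ g) (grade X)
    (map_one X.1.ρ)
    (fun g h => (map_mul X.1.ρ g h).symm)
    (LinearMap.ext fun x => by
      rw [LinearMap.sum_apply]
      exact sum_grade X x)
    (fun g h => LinearMap.ext fun x => by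
      rw [Module.End.mul_apply, grade_grade]
      split_ifs <;> rfl)
    (fun g h => LinearMap.ext fun x => rho_grade X g h x)

instance (X : Center (FDRep ℂ G)) : Module (Double G) (Carrier X) :=
  Module.compHom _ (doubleAct X).toRingHom

theorem double_smul_def (X : Center (FDRep ℂ G)) (a : Double G) (x : Carrier X) :
    a • x = doubleAct X a x := rfl

instance (X : Center (FDRep ℂ G)) : IsScalarTower ℂ (Double G) (Carrier X) where
  smul_assoc c a x := by rw [double_smul_def, map_smul]; rfl

theorem doubleAct_delta_mul_of (X : Center (FDRep ℂ G)) (g k : G) (x : X.1.V) :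
    doubleAct X (Double.delta g * Double.of k) x = grade X g (X.1.ρ k x) := by
  change (∑ g', ∑ k', (Double.delta g * Double.of k) g' k' • (grade X g' * X.1.ρ k')) x = _
  rw [Finset.sum_eq_single g, Finset.sum_eq_single k]
  · rw [Double.delta_mul_apply, if_pos rfl, Double.of_apply, if_pos rfl, one_smul]
    rfl
  · intro k' _ hk
    rw [Double.delta_mul_apply, if_pos rfl, Double.of_apply, if_neg hk, zero_smul]
  · simp
  · intro g' _ hg
    refine Finset.sum_eq_zero fun k' _ => ?_
    rw [Double.delta_mul_apply, if_neg hg, zero_smul]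
  · simp

theorem delta_smul (X : Center (FDRep ℂ G)) (g : G) (x : Carrier X) :
    Double.delta g • x = (grade X g x : X.1.V) := by
  have h := doubleAct_delta_mul_of X g 1 x
  rw [Double.of_one, mul_one] at h
  exact h.trans (congrArg (grade X g) (rho_one_apply X.1 x))

theorem of_smul (X : Center (FDRep ℂ G)) (k : G) (x : Carrier X) :
    Double.of k • x = (X.1.ρ k x : X.1.V) := by
  rw [← one_mul (Double.of k), ← Double.sum_delta, Finset.sum_mul, double_smul_def, map_sum,
    LinearMap.sum_apply, Finset.sum_congr rfl fun g _ => doubleAct_delta_mul_of X g k x]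
  exact sum_grade X _

theorem twistElt_smul (X : Center (FDRep ℂ G)) (k : ℤ) (x : Carrier X) :
    Double.twistElt G k • x = (degreeAct X k x : X.1.V) := by
  rw [Double.twistElt, double_smul_def, map_sum, LinearMap.sum_apply]
  exact (Finset.sum_congr rfl fun g _ => (doubleAct_delta_mul_of X g _ x).trans
    (rho_zpow_grade X g k x).symm).trans (degreeAct_apply X k x).symm

variable {X Y : Center (FDRep ℂ G)}

/-- The module map underlying a morphism of the center. -/
def carrierMap (f : X ⟶ Y) : Carrier X →ₗ[Double G] Carrier Y :=
  Double.linearMapOf (M := Carrier X) (N := Carrier Y) (lin f.f)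
    (fun g x => by rw [delta_smul, delta_smul]; exact lin_grade f g x)
    (fun k x => by rw [of_smul, of_smul]; exact lin_rho f.f k x)

/-- The morphism of the center given by a module map. -/
def ofCarrierMap (f : Carrier X →ₗ[Double G] Carrier Y) : X ⟶ Y :=
  centerHom (f.restrictScalars ℂ)
    (fun k x => (congrArg f (of_smul X k x)).symm.trans
      ((f.map_smul (Double.of k) x).trans (of_smul Y k (f x))))
    (fun g x => (congrArg f (delta_smul X g x)).symm.trans
      ((f.map_smul (Double.delta g) x).trans (delta_smul Y g (f x))))

theorem carrierMap_comp {Z : Center (FDRep ℂ G)} (f : X ⟶ Y) (g : Y ⟶ Z) :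
    carrierMap (f ≫ g) = carrierMap g ∘ₗ carrierMap f := rfl

theorem carrierMap_injective : Function.Injective (carrierMap : (X ⟶ Y) → _) := fun _ _ h =>
  Center.ext _ _ (repHom_ext fun x => LinearMap.congr_fun h x)

theorem isIso_iff_bijective (f : X ⟶ Y) : IsIso f ↔ Function.Bijective (carrierMap f) := by
  constructor
  · intro _
    refine Function.bijective_iff_has_inverse.2 ⟨carrierMap (inv f), fun x => ?_, fun x => ?_⟩
    · rw [← LinearMap.comp_apply, ← carrierMap_comp, IsIso.hom_inv_id]; rfl
    · rw [← LinearMap.comp_apply, ← carrierMap_comp, IsIso.inv_hom_id]; rfl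
  · intro h
    let e := LinearEquiv.ofBijective _ h
    refine ⟨ofCarrierMap e.symm.toLinearMap, carrierMap_injective ?_, carrierMap_injective ?_⟩
    · exact LinearMap.ext e.symm_apply_apply
    · exact LinearMap.ext e.apply_symm_apply

theorem nonempty_iso_of_linearEquiv (e : Carrier X ≃ₗ[Double G] Carrier Y) : Nonempty (X ≅ Y) :=
  have := (isIso_iff_bijective (ofCarrierMap e.toLinearMap)).2 e.bijective
  ⟨asIso (ofCarrierMap e.toLinearMap)⟩

section OfModule

variable (M : Type) [AddCommGroup M] [Module ℂ M] [Module (Double G) M]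
  [IsScalarTower ℂ (Double G) M] [Module.Finite ℂ M]

/-- The representation of `G` on a module over the Drinfeld double. -/
def repOfModule : FDRep ℂ G :=
  FDRep.of (V := M)
    { toFun h := Algebra.lsmul ℂ ℂ M (Double.of h)
      map_one' := by rw [Double.of_one, map_one]
      map_mul' h k := by rw [← Double.of_mul_of, map_mul] }

theorem isGrading_ofModule :
    IsGrading (repOfModule (G := G) M) fun g => Algebra.lsmul ℂ ℂ M (Double.delta g) where
  sum x := by
    have h (y : M) : ∑ g : G, Double.delta g • y = y := by
      rw [← Finset.sum_smul, Double.sum_delta, one_smul]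
    exact h x
  proj g h x := Double.delta_smul_delta_smul (M := M) g h x
  rho g h x := Double.of_smul_delta_smul (M := M) h g x

/-- The object of the center of `Rep(G)` given by a module over the Drinfeld double. -/
def ofModule : Center (FDRep ℂ G) := (isGrading_ofModule M).toCenter

/-- A module over the Drinfeld double is recovered from the object of the center. -/
def carrierOfModule : Carrier (ofModule (G := G) M) ≃ₗ[Double G] M :=
  let i : Carrier (ofModule (G := G) M) →ₗ[ℂ] M := ⟨⟨fun x => x, fun _ _ => rfl⟩, fun _ _ => rfl⟩
  { Double.linearMapOf i
      (fun g x => (congrArg i (delta_smul _ g x)).trans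
        ((isGrading_ofModule M).grade_toCenter g x))
      (fun k x => congrArg i (of_smul _ k x)) with
    invFun x := x
    left_inv _ := rfl
    right_inv _ := rfl }

end OfModule

/-! ### Simple objects of the center -/

instance (p : Submodule (Double G) (Carrier X)) : Module.Finite ℂ p :=
  inferInstanceAs (Module.Finite ℂ (p.restrictScalars ℂ))

/-- The inclusion of a submodule, as a morphism of the center. -/
def submoduleHom (p : Submodule (Double G) (Carrier X)) : ofModule (G := G) p ⟶ X :=
  ofCarrierMap (p.subtype ∘ₗ (carrierOfModule (G := G) p).toLinearMap)

theorem mono_of_injective {f : X ⟶ Y} (h : Function.Injective (carrierMap f)) : Mono f where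
  right_cancellation a b hab := carrierMap_injective <| LinearMap.ext fun x => h <| by
    have := congrArg (fun k => carrierMap k x) hab
    exact this

/-- A monomorphism of the center is injective, as its kernel is an object of the center. -/
theorem injective_of_mono (f : X ⟶ Y) [Mono f] : Function.Injective (carrierMap f) := by
  rw [← LinearMap.ker_eq_bot]
  have h : submoduleHom (LinearMap.ker (carrierMap f)) = 0 := by
    rw [← cancel_mono f, Limits.zero_comp]
    exact carrierMap_injective (LinearMap.ext fun x => x.2)
  rw [eq_bot_iff]
  intro x hx
  exact LinearMap.congr_fun (congrArg carrierMap h) ⟨x, hx⟩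

theorem nontrivial_carrier (X : Center (FDRep ℂ G)) [Simple X] : Nontrivial (Carrier X) := by
  by_contra h
  have := not_nontrivial_iff_subsingleton.1 h
  exact id_nonzero X (carrierMap_injective (LinearMap.ext fun x => Subsingleton.elim _ _))

instance isSimpleModule_carrier (X : Center (FDRep ℂ G)) [Simple X] :
    IsSimpleModule (Double G) (Carrier X) := by
  have := nontrivial_carrier X
  refine (isSimpleModule_iff _ _).2 { eq_bot_or_eq_top := fun p => ?_ }
  have hm : Mono (submoduleHom p) := mono_of_injective <|
    p.injective_subtype.comp (carrierOfModule (G := G) p).injective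
  by_cases h : submoduleHom p = 0
  · left
    rw [eq_bot_iff]
    intro x hx
    exact LinearMap.congr_fun (congrArg carrierMap h) ⟨x, hx⟩
  · right
    rw [eq_top_iff]
    intro x _
    have hi : IsIso (submoduleHom p) := isIso_of_mono_of_nonzero h
    obtain ⟨y, rfl⟩ := ((isIso_iff_bijective _).1 hi).2 x
    exact y.2

theorem simple_of_isSimpleModule [IsSimpleModule (Double G) (Carrier X)] : Simple X where
  mono_isIso_iff_nonzero {Y} f _ := by
    rw [isIso_iff_bijective]
    constructor
    · rintro h rfl
      have := IsSimpleModule.nontrivial (Double G) (Carrier X)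
      obtain ⟨x, hx⟩ := exists_ne (0 : Carrier X)
      obtain ⟨y, rfl⟩ := h.2 x
      exact hx rfl
    · exact fun h => ⟨injective_of_mono f, LinearMap.surjective_of_ne_zero fun h0 =>
        h (carrierMap_injective h0)⟩

end Carrier

/-! ### The Gauss sums -/

section GaussSum

variable {G : Type w} [Group G] [Fintype G] [DecidableEq G]

instance (X : SimpleClass (Center (FDRep ℂ G))) : Simple X.1.out := X.2

instance : Small.{0} (Double G) := inferInstanceAs (Small.{0} (G → G → ℂ))

/-- The isotypic component of the Drinfeld double that belongs to an isomorphism class of simple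
objects. -/
def component (X : SimpleClass (Center (FDRep ℂ G))) : isotypicComponents (Double G) (Double G) :=
  ⟨isotypicComponent (Double G) (Double G) (Carrier X.1.out), by
    obtain ⟨I, ⟨e⟩⟩ := IsSemisimpleRing.exists_linearEquiv_ideal_of_isSimpleModule (Double G)
      (Carrier X.1.out)
    exact ⟨I, IsSimpleModule.congr e.symm, e.isotypicComponent_eq⟩⟩

/-- Simple objects of the center correspond to simple modules over the Drinfeld double, and these to
the isotypic components of the latter. -/
theorem component_bijective :
    Function.Bijective (component : SimpleClass (Center (FDRep ℂ G)) → _) := by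
  constructor
  · intro X Y h
    have hc : isotypicComponent (Double G) (Double G) (Carrier X.1.out) =
      isotypicComponent (Double G) (Double G) (Carrier Y.1.out) := congrArg Subtype.val h
    obtain ⟨I, ⟨e⟩⟩ := IsSemisimpleRing.exists_linearEquiv_ideal_of_isSimpleModule (Double G)
      (Carrier X.1.out)
    have hI : IsSimpleModule (Double G) I := IsSimpleModule.congr e.symm
    have hle : I ≤ isotypicComponent (Double G) (Double G) (Carrier Y.1.out) :=
      hc ▸ le_sSup ⟨e.symm⟩
    obtain ⟨e'⟩ := isIsotypicOfType_submodule_iff.1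
      (IsIsotypicOfType.isotypicComponent (Double G) (Double G) (Carrier Y.1.out)) I hle
    exact Subtype.ext (Quotient.out_equiv_out.1 (nonempty_iso_of_linearEquiv (e.trans e')))
  · rintro ⟨_, S, hS, rfl⟩
    -- `FDRep ℂ G` has its vector spaces in the lowest universe, `S` lies in the one of `G`.
    have : Small.{0} S := small_of_injective S.injective_subtype
    have : IsScalarTower ℂ (Double G) (Shrink.{0} S) :=
      ⟨fun c a x => (Shrink.linearEquiv.{0} (Double G) S).injective <| by
        exact ((Shrink.linearEquiv.{0} (Double G) S).map_smul (c • a) x).trans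
          ((smul_assoc c a _).trans ((congrArg (c • ·)
            ((Shrink.linearEquiv.{0} (Double G) S).map_smul a x)).symm.trans
              ((Shrink.linearEquiv.{0} ℂ S).map_smul c (a • x)).symm))⟩
    have : Module.Finite ℂ S := inferInstanceAs (Module.Finite ℂ (S.restrictScalars ℂ))
    have : Module.Finite ℂ (Shrink.{0} S) := Module.Finite.equiv (Shrink.linearEquiv.{0} ℂ S).symm
    let X : Center (FDRep ℂ G) := ofModule (G := G) (Shrink.{0} S)
    let e : Carrier X ≃ₗ[Double G] S :=
      (carrierOfModule (Shrink.{0} S)).trans (Shrink.linearEquiv.{0} (Double G) S)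
    have : IsSimpleModule (Double G) (Carrier X) := IsSimpleModule.congr e
    have hX : Simple X := simple_of_isSimpleModule
    obtain ⟨i⟩ : Nonempty ((Quotient.mk (isIsomorphicSetoid _) X).out ≅ X) :=
      Quotient.exact (s := isIsomorphicSetoid (Center (FDRep ℂ G))) (Quotient.out_eq _)
    have hout : Simple (Quotient.mk (isIsomorphicSetoid _) X).out := Simple.of_iso i
    refine ⟨⟨Quotient.mk _ X, hout⟩, Subtype.ext ?_⟩
    exact ((LinearEquiv.ofBijective (carrierMap i.hom)
      ((isIso_iff_bijective i.hom).1 inferInstance)).trans e).isotypicComponent_eq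

/-- Schur's lemma for the twist, as an endomorphism of a simple module. -/
theorem exists_twist_eq_smul (X : Center (FDRep ℂ G)) [Simple X] :
    ∃ c : ℂ, (twist X).hom = c • 𝟙 X := by
  obtain ⟨c, hc⟩ := (IsSimpleModule.algebraMap_end_bijective_of_isAlgClosed
    (A := Double G) (V := Carrier X) ℂ).2 (carrierMap (twist X).hom)
  exact ⟨c, carrierMap_injective hc.symm⟩

theorem twistElt_smul_carrier (X : Center (FDRep ℂ G)) [Simple X] (k : ℤ) (x : Carrier X) :
    Double.twistElt G k • x = scalar (twist X).hom ^ k • x := by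
  obtain ⟨c, hc⟩ := exists_twist_eq_smul X
  rw [twistElt_smul, scalar_eq (id_nonzero X) hc]
  exact degreeAct_eq_zpow_smul X hc (nontrivial_carrier X) k x

/-- The Gauss sum is the trace of the multiplication by the twist element on the Drinfeld double. -/
theorem gaussSum_eq (k : ℤ) : gaussSum (Center (FDRep ℂ G)) k =
    (Fintype.card G * Fintype.card {x : G // x ^ k = 1} : ℕ) := by
  let e := Equiv.ofBijective _ (component_bijective (G := G))
  rw [← Double.trace_twistElt, trace_mulLeft _
    (fun c => scalar (twist (e.symm c).1.out).hom ^ k) (fun c a ha => by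
      obtain ⟨X, rfl⟩ := e.surjective c
      rw [Equiv.symm_apply_apply]
      exact mul_eq_smul_of_mem_isotypicComponent (twistElt_smul_carrier X.1.out k) ha), gaussSum]
  refine finsum_eq_of_bijective component component_bijective fun X => ?_
  have h1 : e.symm (component X) = X := e.symm_apply_apply X
  have h2 : Module.finrank ℂ (component X).1 = Module.finrank ℂ (Carrier X.1.out) ^ 2 :=
    finrank_isotypicComponent _
  rw [h1, h2, pivotalDim_center, Nat.cast_pow]
  rfl

end GaussSum

end HigherGauss

end

theorem corollary3p5 {G : Type*} [Group G] [Finite G] (n : ℤ) :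
    Finite (HigherGauss.SimpleClass (CategoryTheory.Center (FDRep ℂ G))) ∧
    HigherGauss.gaussSum (CategoryTheory.Center (FDRep ℂ G)) n =
      ((Nat.card G * Nat.card {x : G // x ^ n = 1} : ℕ) : ℂ) ∧
    HigherGauss.gaussSum (CategoryTheory.Center (FDRep ℂ G)) (-n) =
      ((Nat.card G * Nat.card {x : G // x ^ n = 1} : ℕ) : ℂ) ∧
    0 < Nat.card G * Nat.card {x : G // x ^ n = 1} := by
  classical
  have := Fintype.ofFinite G
  have hone : Nonempty {x : G // x ^ n = 1} := ⟨⟨1, one_zpow n⟩⟩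
  refine ⟨Finite.of_injective _ HigherGauss.component_bijective.1, ?_, ?_,
    Nat.mul_pos Nat.card_pos Nat.card_pos⟩
  · rw [HigherGauss.gaussSum_eq, Nat.card_eq_fintype_card, Nat.card_eq_fintype_card]
  · rw [HigherGauss.gaussSum_eq, Nat.card_eq_fintype_card, Nat.card_eq_fintype_card]
    simp only [zpow_neg, inv_eq_one]
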